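/- Let $d\ge 1$ and $C_V\in\mathbb R$. There is a constant $M>0$, depending only on $d$ and $C_V$, such that the following holds for every complex-valued $V\in L^\infty(\mathbb{R}^d)$ with $\|V\|_\infty\le C_V$ and $V\not\equiv 0$ (that is, $V$ is not almost everywhere zero). If $u\in L^2(\mathbb{R}^d;\mathbb{C})$ satisfies $\|u\|_2=1$ and $-\Delta u+Vu=0$ in $\mathbb{R}^d$ in the sense of distributions, then there is $R_0>0$ (which may depend on $V$ and $u$) such that for all $R\ge R_0$ $$\int_{R<|x|<R+1}|u(x)|^2\,dx\;\ge\; M^{-1}R^{-4/3}\,e^{-M\|V\|_\infty^{2/3}R^{4/3}}.$$ -/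

import Mathlib

open MeasureTheory
open scoped ENNReal ContDiff

/-- `u` solves `-Δ u + V u = 0` on all of `ℝᵈ` in the sense of distributions: `u` and `V u` are
locally integrable and `∫ (u (-Δ φ) + V u φ) = 0` for every test function `φ ∈ C_c^∞(ℝᵈ; ℂ)`. -/
def IsSchrodingerSolution {d : ℕ} (V u : EuclideanSpace ℝ (Fin d) → ℂ) : Prop :=
  LocallyIntegrable u volume ∧
  LocallyIntegrable (fun x => V x * u x) volume ∧
  ∀ φ : EuclideanSpace ℝ (Fin d) → ℂ, ContDiff ℝ ∞ φ → HasCompactSupport φ →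
    ∫ x, (u x * (-(Laplacian.laplacian φ x)) + V x * u x * φ x) = 0

/-- The open annulus `B(0, R₁, R₂)`: the open ball of radius `R₂` without the closed ball
of radius `R₁`, both centred at `0`. -/
def annulus (d : ℕ) (R₁ R₂ : ℝ) : Set (EuclideanSpace ℝ (Fin d)) :=
  Metric.ball 0 R₂ \ Metric.closedBall 0 R₁

/-! The engine is a Carleman inequality with the one-directional weight `φ = a (xₖ + b)² / 2`.
Conjugating `Δ` with `e^φ` gives a symmetric part `S = Δ + |∇φ|²` minus an antisymmetric part `A`.
Since `(S - A)² ≥ -4 S A` pointwise, the cross term alone controls `8a ∫ |∇φ|² e^{2φ} w²` by `∫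
e^{2φ} |Δw|²` (`carleman_estimate`).

With `b = 2(R + 1)` one has `R + 1 ≤ xₖ + b ≤ 3(R + 1)` on the ball of radius `R + 1`. There `|∇φ| ≥
a(R + 1)`, so the left side carries the factor `8a³(R + 1)²`, while `1 ≤ e^{2φ} ≤ exp(9a(R + 1)²)`.
Applied to `χu` with a cutoff `χ` dropping from 1 to 0 across the annulus, the commutator `[Δ, χ]u`
lives in the annulus, and a Caccioppoli inequality removes its gradient term
(`exists_carleman_cutoff`). Mollification carries the estimate to weak `L²` solutions
(`exists_carleman_cutoff_weak`).

Choosing `a³(R + 1)² = ‖V‖²` lets the left side absorb `Vu` (`exists_absorbed_estimate`) and makes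
the exponent `9a(R + 1)² = 9‖V‖^{2/3}(R + 1)^{4/3}`, the source of both powers in the theorem. For
large `R` the ball holds at least half of the mass, so the annulus cannot hold too little. The
remaining factor `‖V‖²` is paid for by `R^{-4/3}`, which is eventually below `3‖V‖²`. -/

/-- The `i`-th partial derivative of a real function on `ℝᵈ`. -/
noncomputable def pderiv {d : ℕ} (i : Fin d) (f : EuclideanSpace ℝ (Fin d) → ℝ) :
    EuclideanSpace ℝ (Fin d) → ℝ :=
  fun x => fderiv ℝ f x (EuclideanSpace.single i 1)

/-- The Laplacian of a real function on `ℝᵈ` as the sum of the pure second partial derivatives. -/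
noncomputable def lap {d : ℕ} (f : EuclideanSpace ℝ (Fin d) → ℝ) :
    EuclideanSpace ℝ (Fin d) → ℝ :=
  fun x => ∑ i, pderiv i (pderiv i f) x

/-! ### Calculus of coordinate derivatives and Green's identities. -/

section PartialDerivatives

variable {d : ℕ} {f g : EuclideanSpace ℝ (Fin d) → ℝ}

@[fun_prop]
theorem ContDiff.pderiv (i : Fin d) (hf : ContDiff ℝ ∞ f) : ContDiff ℝ ∞ (pderiv i f) := by
  unfold _root_.pderiv
  exact (hf.fderiv_right (m := ∞) (by simp)).clm_apply contDiff_const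

@[fun_prop]
theorem ContDiff.lap (hf : ContDiff ℝ ∞ f) : ContDiff ℝ ∞ (lap f) := by
  unfold _root_.lap
  fun_prop

theorem ContDiff.hasFDerivAt_infty (hf : ContDiff ℝ ∞ f) (x) : HasFDerivAt f (fderiv ℝ f x) x :=
  (hf.differentiable (by simp) x).hasFDerivAt

theorem pderiv_eq_of_hasFDerivAt {x} {f' : EuclideanSpace ℝ (Fin d) →L[ℝ] ℝ} (i : Fin d)
    (h : HasFDerivAt f f' x) : pderiv i f x = f' (EuclideanSpace.single i 1) := by
  rw [pderiv, h.fderiv]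

theorem pderiv_mul (i : Fin d) (hf : ContDiff ℝ ∞ f) (hg : ContDiff ℝ ∞ g) (x) :
    pderiv i (fun y => f y * g y) x = f x * pderiv i g x + g x * pderiv i f x := by
  rw [pderiv_eq_of_hasFDerivAt i (f := fun y => f y * g y)
    ((hf.hasFDerivAt_infty x).mul (hg.hasFDerivAt_infty x))]
  simp [pderiv]

theorem pderiv_add (i : Fin d) (hf : ContDiff ℝ ∞ f) (hg : ContDiff ℝ ∞ g) (x) :
    pderiv i (fun y => f y + g y) x = pderiv i f x + pderiv i g x := by
  rw [pderiv_eq_of_hasFDerivAt i (f := fun y => f y + g y)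
    ((hf.hasFDerivAt_infty x).add (hg.hasFDerivAt_infty x))]
  simp [pderiv]

theorem pderiv_const_mul (i : Fin d) (hf : ContDiff ℝ ∞ f) (c : ℝ) (x) :
    pderiv i (fun y => c * f y) x = c * pderiv i f x := by
  rw [pderiv_eq_of_hasFDerivAt i ((hf.hasFDerivAt_infty x).const_mul c)]
  simp [pderiv]

theorem pderiv_sum {ι : Type*} (s : Finset ι) (i : Fin d)
    {F : ι → EuclideanSpace ℝ (Fin d) → ℝ} (hF : ∀ j, ContDiff ℝ ∞ (F j)) (x) :
    pderiv i (fun y => ∑ j ∈ s, F j y) x = ∑ j ∈ s, pderiv i (F j) x := by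
  rw [pderiv_eq_of_hasFDerivAt i
    (HasFDerivAt.fun_sum fun j _ => (hF j).hasFDerivAt_infty x)]
  simp [pderiv]

theorem pderiv_comp (i : Fin d) {h : ℝ → ℝ} (hh : ContDiff ℝ ∞ h) (hf : ContDiff ℝ ∞ f) (x) :
    pderiv i (fun y => h (f y)) x = deriv h (f x) * pderiv i f x := by
  have h1 : HasDerivAt h (deriv h (f x)) (f x) := (hh.differentiable (by simp) _).hasDerivAt
  rw [pderiv_eq_of_hasFDerivAt i (f := fun y => h (f y))
    (h1.comp_hasFDerivAt x (hf.hasFDerivAt_infty x))]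
  simp [pderiv]

theorem pderiv_comm (i j : Fin d) (hf : ContDiff ℝ ∞ f) (x) :
    pderiv i (pderiv j f) x = pderiv j (pderiv i f) x := by
  have key : ∀ k l : Fin d, pderiv k (pderiv l f) x =
      fderiv ℝ (fderiv ℝ f) x (EuclideanSpace.single k 1) (EuclideanSpace.single l 1) := by
    intro k l
    have h1 : HasFDerivAt (fderiv ℝ f) (fderiv ℝ (fderiv ℝ f) x) x :=
      ((hf.fderiv_right (m := ∞) (by simp)).differentiable (by simp) x).hasFDerivAt
    have h2 := h1.clm_apply (hasFDerivAt_const (EuclideanSpace.single l (1 : ℝ)) x)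
    rw [pderiv_eq_of_hasFDerivAt k (f := pderiv l f) h2]
    simp
  rw [key, key]
  exact (hf.contDiffAt.isSymmSndFDerivAt (by
    simpa [minSmoothness_of_isRCLikeNormedField] using
      WithTop.coe_le_coe.2 (le_top : (2 : ℕ∞) ≤ ⊤))).eq _ _

theorem HasCompactSupport.pderiv (i : Fin d) (hf : HasCompactSupport f) :
    HasCompactSupport (pderiv i f) :=
  hf.fderiv_apply ℝ _

theorem HasCompactSupport.lap (hf : HasCompactSupport f) : HasCompactSupport (lap f) := by
  refine hf.mono' ?_
  intro x hx
  by_contra hxs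
  apply hx
  refine Finset.sum_eq_zero fun i _ => ?_
  by_contra h
  have h1 : x ∈ tsupport (_root_.pderiv i (_root_.pderiv i f)) := subset_tsupport _ h
  exact hxs (tsupport_fderiv_apply_subset ℝ _ (tsupport_fderiv_apply_subset ℝ _ h1))

theorem laplacian_eq_lap (hf : ContDiff ℝ ∞ f) (x) : Laplacian.laplacian f x = lap f x := by
  rw [InnerProductSpace.laplacian_eq_iteratedFDeriv_orthonormalBasis f
    (EuclideanSpace.basisFun (Fin d) ℝ)]
  refine Finset.sum_congr rfl fun i _ => ?_
  rw [iteratedFDeriv_two_apply]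
  have h1 : HasFDerivAt (fderiv ℝ f) (fderiv ℝ (fderiv ℝ f) x) x :=
    ((hf.fderiv_right (m := ∞) (by simp)).differentiable (by simp) x).hasFDerivAt
  have h2 := h1.clm_apply (hasFDerivAt_const (EuclideanSpace.single i (1 : ℝ)) x)
  rw [pderiv_eq_of_hasFDerivAt i (f := pderiv i f) h2]
  simp

theorem lap_mul (hf : ContDiff ℝ ∞ f) (hg : ContDiff ℝ ∞ g) (x) :
    lap (fun y => f y * g y) x =
      f x * lap g x + 2 * ∑ i, pderiv i f x * pderiv i g x + g x * lap f x := by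
  simp only [lap, Finset.mul_sum, ← Finset.sum_add_distrib]
  refine Finset.sum_congr rfl fun i _ => ?_
  have h : pderiv i (fun y => f y * g y) = fun x => f x * pderiv i g x + g x * pderiv i f x :=
    funext (pderiv_mul i hf hg)
  rw [h, pderiv_add i (by fun_prop) (by fun_prop), pderiv_mul i hf (by fun_prop),
    pderiv_mul i hg (by fun_prop)]
  ring

theorem lap_comp {h : ℝ → ℝ} (hh : ContDiff ℝ ∞ h) (hf : ContDiff ℝ ∞ f) (x) :
    lap (fun y => h (f y)) x =
      deriv (deriv h) (f x) * ∑ i, pderiv i f x ^ 2 + deriv h (f x) * lap f x := by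
  simp only [lap, Finset.mul_sum, ← Finset.sum_add_distrib]
  refine Finset.sum_congr rfl fun i _ => ?_
  have e : pderiv i (fun y => h (f y)) = fun x => deriv h (f x) * pderiv i f x :=
    funext (pderiv_comp i hh hf)
  have hh' : ContDiff ℝ ∞ (deriv h) := by
    have := (contDiff_infty_iff_deriv (f := h)).1 hh
    exact this.2
  rw [e, pderiv_mul i (by fun_prop) (by fun_prop), pderiv_comp i hh' hf]
  ring

theorem integral_pderiv_eq_zero (i : Fin d) (hf : ContDiff ℝ ∞ f) (hs : HasCompactSupport f) :
    ∫ x, pderiv i f x = 0 := by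
  have h := integral_mul_fderiv_eq_neg_fderiv_mul_of_integrable (𝕜 := ℝ)
    (μ := (volume : Measure (EuclideanSpace ℝ (Fin d)))) (f := fun _ => (1 : ℝ)) (g := f)
    (v := EuclideanSpace.single i 1) (by simp)
    (by simp only [one_mul]; exact
      (hf.pderiv i).continuous.integrable_of_hasCompactSupport (hs.pderiv i))
    (by simpa using hf.continuous.integrable_of_hasCompactSupport hs)
    (by fun_prop) (fun x _ => hf.differentiable (by simp) x)
  simpa [pderiv] using h

/-- Green's first identity. -/
theorem integral_lap_mul (hf : ContDiff ℝ ∞ f) (hg : ContDiff ℝ ∞ g) (hs : HasCompactSupport f) :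
    ∫ x, lap f x * g x = - ∫ x, ∑ i, pderiv i f x * pderiv i g x := by
  have hint : ∀ i, Integrable (fun x => pderiv i (pderiv i f) x * g x) := fun i =>
    (Continuous.integrable_of_hasCompactSupport
      (((hf.pderiv i).pderiv i).mul hg).continuous ((hs.pderiv i).pderiv i).mul_right)
  have hint' : ∀ i, Integrable (fun x => pderiv i f x * pderiv i g x) := fun i =>
    (Continuous.integrable_of_hasCompactSupport
      ((hf.pderiv i).mul (hg.pderiv i)).continuous (hs.pderiv i).mul_right)
  simp only [lap, Finset.sum_mul]
  rw [integral_finsetSum _ fun i _ => hint i, integral_finsetSum _ fun i _ => hint' i,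
    ← Finset.sum_neg_distrib]
  refine Finset.sum_congr rfl fun i _ => ?_
  have h := integral_pderiv_eq_zero i ((hf.pderiv i).mul hg) (hs.pderiv i).mul_right
  rw [integral_congr_ae (Filter.Eventually.of_forall (pderiv_mul i (hf.pderiv i) hg)),
    integral_add (hint' i) (by simpa [mul_comm] using hint i)] at h
  simp only [mul_comm (g _)] at h
  linarith

/-- Integrate `Δ(fg)`, which gives zero, and eliminate the cross term by Green's first identity. It
serves to move `Δ` from `u²` onto a cutoff. -/
theorem integral_mul_lap_comm (hf : ContDiff ℝ ∞ f) (hg : ContDiff ℝ ∞ g)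
    (hs : HasCompactSupport f) : ∫ x, lap f x * g x = ∫ x, f x * lap g x := by
  have hint : Integrable (fun x => lap f x * g x) :=
    (hf.lap.mul hg).continuous.integrable_of_hasCompactSupport hs.lap.mul_right
  have hint1 : Integrable (fun x => f x * lap g x) :=
    (hf.mul hg.lap).continuous.integrable_of_hasCompactSupport hs.mul_right
  have hint2 : Integrable (fun x => ∑ i, pderiv i f x * pderiv i g x) := by
    refine integrable_finsetSum _ fun i _ => ?_
    exact ((hf.pderiv i).mul (hg.pderiv i)).continuous.integrable_of_hasCompactSupport
      (hs.pderiv i).mul_right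
  have h0 : ∫ x, lap (fun y => f y * g y) x = 0 := by
    simp only [lap]
    rw [integral_finsetSum]
    · exact Finset.sum_eq_zero fun i _ =>
        integral_pderiv_eq_zero i ((hf.mul hg).pderiv i) (hs.mul_right.pderiv i)
    · exact fun i _ => (((hf.mul hg).pderiv i).pderiv i).continuous.integrable_of_hasCompactSupport
        ((hs.mul_right.pderiv i).pderiv i)
  simp only [lap_mul hf hg] at h0
  rw [integral_add (f := fun x => f x * lap g x + 2 * ∑ i, pderiv i f x * pderiv i g x)
      (hint1.add (hint2.const_mul 2)) (by simpa [mul_comm] using hint),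
    integral_add hint1 (hint2.const_mul 2), integral_const_mul] at h0
  have h1 := integral_lap_mul hf hg hs
  simp only [mul_comm (g _)] at h0
  linarith

end PartialDerivatives

/-! ### The Carleman estimate with a one-directional quadratic weight. -/

section Carleman

variable {d : ℕ}

/-- The affine function `a (xₖ + b)`. -/
def affineCoord (k : Fin d) (a b : ℝ) (x : EuclideanSpace ℝ (Fin d)) : ℝ := a * (x k + b)

/-- The quadratic Carleman weight `a (xₖ + b)² / 2`, whose gradient is `affineCoord k a b · eₖ`. -/
noncomputable def carlemanWeight (k : Fin d) (a b : ℝ) (x : EuclideanSpace ℝ (Fin d)) : ℝ :=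
  a * (x k + b) ^ 2 / 2

@[fun_prop]
theorem contDiff_affineCoord (k : Fin d) (a b : ℝ) : ContDiff ℝ ∞ (affineCoord k a b) := by
  unfold affineCoord; fun_prop

@[fun_prop]
theorem contDiff_carlemanWeight (k : Fin d) (a b : ℝ) : ContDiff ℝ ∞ (carlemanWeight k a b) := by
  unfold carlemanWeight; fun_prop

theorem pderiv_coord (k i : Fin d) (x) :
    pderiv i (fun y : EuclideanSpace ℝ (Fin d) => y k) x = if i = k then 1 else 0 := by
  rw [pderiv_eq_of_hasFDerivAt i (f := fun y => y k)
    (EuclideanSpace.proj k : EuclideanSpace ℝ (Fin d) →L[ℝ] ℝ).hasFDerivAt]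
  simp [eq_comm]

theorem pderiv_affineCoord (k i : Fin d) (a b : ℝ) (x) :
    pderiv i (affineCoord k a b) x = if i = k then a else 0 := by
  have h : affineCoord k a b = fun y => (fun t => a * (t + b)) (y k) := rfl
  rw [h, pderiv_comp i (h := fun t => a * (t + b)) (by fun_prop) (by fun_prop), pderiv_coord]
  have : deriv (fun t : ℝ => a * (t + b)) (x k) = a := by
    simp
  rw [this]; simp

theorem pderiv_carlemanWeight (k i : Fin d) (a b : ℝ) (x) :
    pderiv i (carlemanWeight k a b) x = if i = k then affineCoord k a b x else 0 := by
  have h : carlemanWeight k a b = fun y => (fun t => a * (t + b) ^ 2 / 2) (y k) := rfl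
  rw [h, pderiv_comp i (h := fun t => a * (t + b) ^ 2 / 2) (by fun_prop) (by fun_prop),
    pderiv_coord]
  have : deriv (fun t : ℝ => a * (t + b) ^ 2 / 2) (x k) = affineCoord k a b x := by
    have h1 : HasDerivAt (fun t : ℝ => a * (t + b) ^ 2 / 2)
        (a * (((2 : ℕ) : ℝ) * (x k + b) ^ (2 - 1) * 1) / 2) (x k) :=
      ((((hasDerivAt_id (x k)).add_const b).pow 2).const_mul a).div_const 2
    rw [h1.deriv, affineCoord]; push_cast; ring
  rw [this]; simp

/-- The Laplacian conjugated with `exp (carlemanWeight k a b)`. -/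
theorem lap_exp_mul (k : Fin d) (a b : ℝ) {w : EuclideanSpace ℝ (Fin d) → ℝ}
    (hw : ContDiff ℝ ∞ w) (x) :
    lap (fun y => Real.exp (carlemanWeight k a b y) * w y) x =
      Real.exp (carlemanWeight k a b x) * (lap w x + 2 * affineCoord k a b x * pderiv k w x +
        (affineCoord k a b x ^ 2 + a) * w x) := by
  have he : ContDiff ℝ ∞ fun y => Real.exp (carlemanWeight k a b y) := by fun_prop
  have hpe : ∀ i y, pderiv i (fun y => Real.exp (carlemanWeight k a b y)) y =
      Real.exp (carlemanWeight k a b y) * if i = k then affineCoord k a b y else 0 := by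
    intro i y
    rw [pderiv_comp i Real.contDiff_exp (by fun_prop), pderiv_carlemanWeight, Real.deriv_exp]
  have hlapw : lap (carlemanWeight k a b) x = a := by
    have : ∀ i, pderiv i (carlemanWeight k a b) =
        fun y => (if i = k then 1 else 0) * affineCoord k a b y := by
      intro i; funext y; rw [pderiv_carlemanWeight]; split_ifs <;> simp
    simp only [lap, this]
    rw [Finset.sum_eq_single k]
    · rw [pderiv_const_mul k (by fun_prop), pderiv_affineCoord]; simp
    · intro i _ hi
      rw [pderiv_const_mul i (by fun_prop)]; simp [hi]
    · simp
  rw [lap_mul he hw, lap_comp Real.contDiff_exp (by fun_prop), hlapw]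
  simp only [hpe, pderiv_carlemanWeight, Real.deriv_exp]
  simp [ite_pow]
  ring

theorem pderiv_exp_mul (k : Fin d) (a b : ℝ) {w : EuclideanSpace ℝ (Fin d) → ℝ}
    (hw : ContDiff ℝ ∞ w) (x) :
    pderiv k (fun y => Real.exp (carlemanWeight k a b y) * w y) x =
      Real.exp (carlemanWeight k a b x) * (pderiv k w x + affineCoord k a b x * w x) := by
  rw [pderiv_mul k (by fun_prop) hw, pderiv_comp k Real.contDiff_exp (by fun_prop),
    pderiv_carlemanWeight, Real.deriv_exp]
  simp
  ring

/-- The commutator of the symmetric and antisymmetric parts of the conjugated Laplacian. -/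
theorem integral_commutator (k : Fin d) (a b : ℝ) {v : EuclideanSpace ℝ (Fin d) → ℝ}
    (hv : ContDiff ℝ ∞ v) (hs : HasCompactSupport v) :
    ∫ x, (lap v x + affineCoord k a b x ^ 2 * v x) *
        (4 * affineCoord k a b x * pderiv k v x + 2 * a * v x) =
      - ∫ x, (4 * a * pderiv k v x ^ 2 + 4 * a * affineCoord k a b x ^ 2 * v x ^ 2) := by
  set p := affineCoord k a b with hp_def
  have hp : ContDiff ℝ ∞ p := contDiff_affineCoord k a b
  have hdp : ∀ i x, pderiv i p x = if i = k then a else 0 :=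
    fun i x => pderiv_affineCoord k i a b x
  have I : ∀ {f : EuclideanSpace ℝ (Fin d) → ℝ}, ContDiff ℝ ∞ f → HasCompactSupport f →
      Integrable f := fun hf hfs => hf.continuous.integrable_of_hasCompactSupport hfs
  -- The proof isolates two total derivatives in direction `k`, of `p |∇v|²` and of `p³ v²`. Both
  -- integrate to zero; what is left over is the commutator.
  have e1 : ∀ x, pderiv k (fun y => p y * ∑ i, pderiv i v y ^ 2) x =
      a * ∑ i, pderiv i v x ^ 2 + 2 * p x * ∑ i, pderiv i v x * pderiv k (pderiv i v) x := by
    intro x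
    rw [pderiv_mul k hp (by fun_prop), pderiv_sum _ k (fun j => by fun_prop), hdp]
    have : ∀ j, pderiv k (fun y => pderiv j v y ^ 2) x =
        2 * (pderiv j v x * pderiv k (pderiv j v) x) := by
      intro j
      simp only [sq]
      rw [pderiv_mul k (by fun_prop) (by fun_prop)]; ring
    simp only [this, ← Finset.mul_sum]
    simp; ring
  have e2 : ∀ x, pderiv k (fun y => (p y * p y * p y) * (v y * v y)) x =
      3 * a * p x ^ 2 * v x ^ 2 + 2 * p x ^ 3 * v x * pderiv k v x := by
    intro x
    rw [pderiv_mul k (by fun_prop) (by fun_prop), pderiv_mul k (by fun_prop) (by fun_prop),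
      pderiv_mul k (by fun_prop) (by fun_prop), pderiv_mul k (by fun_prop) (by fun_prop), hdp]
    simp; ring
  have s1 : HasCompactSupport (fun y => p y * ∑ i, pderiv i v y ^ 2) := by
    refine HasCompactSupport.mul_left ?_
    refine hs.mono' fun x hx => ?_
    by_contra hxs
    refine hx (Finset.sum_eq_zero fun i _ => ?_)
    have : pderiv i v x = 0 := by
      by_contra h
      exact hxs (tsupport_fderiv_apply_subset ℝ _ (subset_tsupport _ h))
    simp [this]
  have s2 : HasCompactSupport (fun y => (p y * p y * p y) * (v y * v y)) :=
    HasCompactSupport.mul_left hs.mul_right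
  have z1 := integral_pderiv_eq_zero k (by fun_prop) s1
  have z2 := integral_pderiv_eq_zero k (by fun_prop) s2
  have hq : ContDiff ℝ ∞ fun x => 4 * p x * pderiv k v x + 2 * a * v x := by fun_prop
  have green := integral_lap_mul hv hq hs
  -- The zeroth-order term `2a v`, coming from `Δφ = a`, supplies the `2a |∇v|²` that completes the
  -- total derivative, so only `(∂ₖv)²` remains.
  have e3 : ∀ x, ∑ i, pderiv i v x * pderiv i (fun x => 4 * p x * pderiv k v x + 2 * a * v x) x =
      4 * a * pderiv k v x ^ 2 + 2 * pderiv k (fun y => p y * ∑ i, pderiv i v y ^ 2) x := by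
    intro x
    have : ∀ i, pderiv i (fun x => 4 * p x * pderiv k v x + 2 * a * v x) x =
        4 * p x * pderiv k (pderiv i v) x + pderiv k v x * (4 * if i = k then a else 0) +
          2 * a * pderiv i v x := by
      intro i
      rw [pderiv_add i (by fun_prop) (by fun_prop), pderiv_mul i (by fun_prop) (by fun_prop),
        pderiv_const_mul i (by fun_prop), pderiv_const_mul i (by fun_prop), hdp,
        pderiv_comm i k hv]
    rw [e1]
    simp only [this, mul_add, Finset.sum_add_distrib, Finset.mul_sum]
    simp
    have c1 : ∑ i, pderiv i v x * (2 * a * pderiv i v x) = ∑ i, 2 * (a * pderiv i v x ^ 2) :=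
      Finset.sum_congr rfl fun i _ => by ring
    have c2 : ∑ i, pderiv i v x * (4 * p x * pderiv k (pderiv i v) x) =
        ∑ i, 2 * (2 * p x * (pderiv i v x * pderiv k (pderiv i v) x)) :=
      Finset.sum_congr rfl fun i _ => by ring
    rw [c1, c2]
    ring
  have id1 : ∀ x, (lap v x + p x ^ 2 * v x) * (4 * p x * pderiv k v x + 2 * a * v x) =
      lap v x * (4 * p x * pderiv k v x + 2 * a * v x) +
        (2 * pderiv k (fun y => (p y * p y * p y) * (v y * v y)) x -
          4 * a * p x ^ 2 * v x ^ 2) := by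
    intro x; rw [e2]; ring
  have i1 : Integrable fun x => lap v x * (4 * p x * pderiv k v x + 2 * a * v x) :=
    I (by fun_prop) hs.lap.mul_right
  have i2 : Integrable (pderiv k (fun y => (p y * p y * p y) * (v y * v y))) :=
    I (by fun_prop) (s2.pderiv k)
  have i3 : Integrable fun x => 4 * a * p x ^ 2 * v x ^ 2 := by
    refine I (by fun_prop) (HasCompactSupport.mul_left ?_)
    simp only [sq]; exact hs.mul_right
  have i4 : Integrable fun x => 4 * a * pderiv k v x ^ 2 := by
    refine I (by fun_prop) (HasCompactSupport.mul_left ?_)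
    simp only [sq]; exact (hs.pderiv k).mul_right
  have i5 : Integrable (pderiv k (fun y => p y * ∑ i, pderiv i v y ^ 2)) :=
    I (by fun_prop) (s1.pderiv k)
  simp only [e3] at green
  rw [integral_add i4 (i5.const_mul 2), integral_const_mul 2, z1] at green
  simp only [id1]
  have i6 : Integrable fun x => 2 * pderiv k (fun y => (p y * p y * p y) * (v y * v y)) x -
      4 * a * p x ^ 2 * v x ^ 2 := (i2.const_mul 2).sub i3
  rw [integral_add i1 i6, integral_sub (i2.const_mul 2) i3,
    integral_const_mul 2, z2, green, integral_add i4 i3]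
  ring

/-- A Carleman estimate for the Laplacian with a weight depending on one coordinate. -/
theorem carleman_estimate (k : Fin d) {a : ℝ} (ha : 0 ≤ a) (b : ℝ)
    {w : EuclideanSpace ℝ (Fin d) → ℝ} (hw : ContDiff ℝ ∞ w) (hs : HasCompactSupport w) :
    ∫ x, 8 * a * affineCoord k a b x ^ 2 * (Real.exp (carlemanWeight k a b x) * w x) ^ 2 ≤
      ∫ x, (Real.exp (carlemanWeight k a b x) * lap w x) ^ 2 := by
  set v : EuclideanSpace ℝ (Fin d) → ℝ := fun x => Real.exp (carlemanWeight k a b x) * w x with hv_def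
  have hv : ContDiff ℝ ∞ v := by fun_prop
  have hvs : HasCompactSupport v := hs.mul_left
  have hp : ContDiff ℝ ∞ (affineCoord k a b) := contDiff_affineCoord k a b
  have I : ∀ {f : EuclideanSpace ℝ (Fin d) → ℝ}, ContDiff ℝ ∞ f → HasCompactSupport f →
      Integrable f := fun hf hfs => hf.continuous.integrable_of_hasCompactSupport hfs
  have hcomm := integral_commutator k a b hv hvs
  -- This is `(S - A)² = (S + A)² - 4 S A ≥ -4 S A`. Dropping `(S + A)²` rather than `S² + A²`
  -- doubles the commutator, whence 8 instead of 4.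
  have hpt : ∀ x, -(2 * ((lap v x + affineCoord k a b x ^ 2 * v x) *
        (4 * affineCoord k a b x * pderiv k v x + 2 * a * v x))) ≤
      (Real.exp (carlemanWeight k a b x) * lap w x) ^ 2 := by
    intro x
    have h1 : Real.exp (carlemanWeight k a b x) * lap w x =
        (lap v x + affineCoord k a b x ^ 2 * v x) -
          (2 * affineCoord k a b x * pderiv k v x + a * v x) := by
      rw [hv_def, lap_exp_mul k a b hw, pderiv_exp_mul k a b hw]
      ring
    rw [h1]
    nlinarith [sq_nonneg ((lap v x + affineCoord k a b x ^ 2 * v x) +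
          (2 * affineCoord k a b x * pderiv k v x + a * v x))]
  have i1 : Integrable fun x => (lap v x + affineCoord k a b x ^ 2 * v x) *
        (4 * affineCoord k a b x * pderiv k v x + 2 * a * v x) :=
    I (by fun_prop) (hvs.lap.add hvs.mul_left).mul_right
  have i2 : Integrable fun x => (Real.exp (carlemanWeight k a b x) * lap w x) ^ 2 := by
    refine I (by fun_prop) ?_
    simp only [sq]
    exact hs.lap.mul_left.mul_right
  have i3 : Integrable fun x => 8 * a * affineCoord k a b x ^ 2 * v x ^ 2 := by
    refine I (by fun_prop) (HasCompactSupport.mul_left ?_)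
    simp only [sq]; exact hvs.mul_right
  have i4 : Integrable fun x => 4 * a * pderiv k v x ^ 2 := by
    refine I (by fun_prop) (HasCompactSupport.mul_left ?_)
    simp only [sq]; exact (hvs.pderiv k).mul_right
  have i5 : Integrable fun x => 4 * a * pderiv k v x ^ 2 +
      4 * a * affineCoord k a b x ^ 2 * v x ^ 2 := by
    refine i4.add (I (by fun_prop) (HasCompactSupport.mul_left ?_))
    simp only [sq]; exact hvs.mul_right
  calc ∫ x, 8 * a * affineCoord k a b x ^ 2 * v x ^ 2
      ≤ ∫ x, 2 * (4 * a * pderiv k v x ^ 2 + 4 * a * affineCoord k a b x ^ 2 * v x ^ 2) := by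
        refine integral_mono i3 (i5.const_mul 2) fun x => ?_
        have : 0 ≤ a * pderiv k v x ^ 2 := by positivity
        dsimp only
        linarith
    _ = ∫ x, -(2 * ((lap v x + affineCoord k a b x ^ 2 * v x) *
        (4 * affineCoord k a b x * pderiv k v x + 2 * a * v x))) := by
        rw [integral_neg, integral_const_mul, integral_const_mul, hcomm]; ring
    _ ≤ _ := integral_mono (i1.const_mul 2).neg i2 hpt

end Carleman

/-! ### Radial cutoffs with bounds uniform in `R`. -/

section Cutoff

theorem exists_bound_of_eventually_const {h : ℝ → ℝ} (hh : ContDiff ℝ ∞ h)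
    (h0 : ∀ t, t < 1 / 4 ∨ 3 / 4 < t → h t = 0) : ∃ C, ∀ t, |h t| ≤ C := by
  have hs : HasCompactSupport h :=
    HasCompactSupport.intro (isCompact_Icc (a := (1 / 4 : ℝ)) (b := 3 / 4)) fun t ht => by
      apply h0
      by_contra hcon
      push Not at hcon
      exact ht ⟨hcon.1, hcon.2⟩
  obtain ⟨C, hC⟩ := hs.exists_bound_of_continuous hh.continuous
  exact ⟨C, hC⟩

theorem deriv_eq_zero_of_locally_const {h : ℝ → ℝ} {c₁ c₂ : ℝ} (h1 : ∀ t, t < 1 / 4 → h t = c₁)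
    (h2 : ∀ t, 3 / 4 < t → h t = c₂) (t : ℝ) (ht : t < 1 / 4 ∨ 3 / 4 < t) : deriv h t = 0 := by
  rcases ht with ht | ht
  · have : h =ᶠ[nhds t] fun _ => c₁ := by
      filter_upwards [Iio_mem_nhds ht] with y hy using h1 y hy
    rw [this.deriv_eq]; simp
  · have : h =ᶠ[nhds t] fun _ => c₂ := by
      filter_upwards [Ioi_mem_nhds ht] with y hy using h2 y hy
    rw [this.deriv_eq]; simp

theorem ContDiff.deriv_infty {h : ℝ → ℝ} (hh : ContDiff ℝ ∞ h) : ContDiff ℝ ∞ (deriv h) :=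
  (contDiff_infty_iff_deriv.1 hh).2

/-- The transition is confined to `[1/4, 3/4]`, so `g` is constant near 0 and near 1, and all
derivatives vanish on the boundary spheres too. The bounds on `(g')²` are there because this square
becomes the second cutoff `ζ`. -/
theorem exists_cutoff_profile : ∃ g : ℝ → ℝ, ∃ C : ℝ, ContDiff ℝ ∞ g ∧
    (∀ t, t < 1 / 4 → g t = 1) ∧ (∀ t, 3 / 4 < t → g t = 0) ∧
    (∀ t, |deriv g t| ≤ C) ∧ (∀ t, |deriv (deriv g) t| ≤ C) ∧
    (∀ t, |deriv (fun t => deriv g t ^ 2) t| ≤ C) ∧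
    (∀ t, |deriv (deriv (fun t => deriv g t ^ 2)) t| ≤ C) := by
  set g : ℝ → ℝ := fun t => 1 - Real.smoothTransition (2 * t - 1 / 2) with hg
  have hsm : ContDiff ℝ ∞ g := by
    have : ContDiff ℝ ∞ Real.smoothTransition := Real.smoothTransition.contDiff
    fun_prop
  have hg1 : ∀ t, t < 1 / 4 → g t = 1 := fun t ht => by
    rw [hg]; dsimp only
    rw [Real.smoothTransition.zero_of_nonpos (by linarith)]; simp
  have hg0 : ∀ t, 3 / 4 < t → g t = 0 := fun t ht => by
    rw [hg]; dsimp only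
    rw [Real.smoothTransition.one_of_one_le (by linarith)]; simp
  have d1 := hsm.deriv_infty
  have z1 := deriv_eq_zero_of_locally_const hg1 hg0
  have d2 := d1.deriv_infty
  have z2 := deriv_eq_zero_of_locally_const (fun t ht => z1 t (.inl ht)) fun t ht => z1 t (.inr ht)
  have d3 : ContDiff ℝ ∞ (fun t => deriv g t ^ 2) := by fun_prop
  have z3 : ∀ t, t < 1 / 4 ∨ 3 / 4 < t → deriv g t ^ 2 = 0 := fun t ht => by simp [z1 t ht]
  have d4 := d3.deriv_infty
  have z4 := deriv_eq_zero_of_locally_const (fun t ht => z3 t (.inl ht)) fun t ht => z3 t (.inr ht)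
  have d5 := d4.deriv_infty
  have z5 := deriv_eq_zero_of_locally_const (fun t ht => z4 t (.inl ht)) fun t ht => z4 t (.inr ht)
  obtain ⟨C1, h1⟩ := exists_bound_of_eventually_const d1 z1
  obtain ⟨C2, h2⟩ := exists_bound_of_eventually_const d2 z2
  obtain ⟨C3, h3⟩ := exists_bound_of_eventually_const d4 z4
  obtain ⟨C4, h4⟩ := exists_bound_of_eventually_const d5 z5
  refine ⟨g, max (max C1 C2) (max C3 C4), hsm, hg1, hg0,
    fun t => (h1 t).trans ?_, fun t => (h2 t).trans ?_, fun t => (h3 t).trans ?_,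
    fun t => (h4 t).trans ?_⟩
  all_goals simp

variable {d : ℕ}

/-- An affine function of `‖x‖²` which is `0` on the sphere of radius `R` and `1` on the sphere
of radius `R + 1`. -/
noncomputable def radialParam (R : ℝ) (x : EuclideanSpace ℝ (Fin d)) : ℝ :=
  (‖x‖ ^ 2 - R ^ 2) / (2 * R + 1)

@[fun_prop]
theorem contDiff_radialParam (R : ℝ) :
    ContDiff ℝ ∞ (radialParam R : EuclideanSpace ℝ (Fin d) → ℝ) := by
  unfold radialParam
  exact ((contDiff_norm_sq ℝ).sub contDiff_const).div_const _

theorem pderiv_radialParam (R : ℝ) (i : Fin d) (x) :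
    pderiv i (radialParam R) x = 2 / (2 * R + 1) * x i := by
  have h : HasFDerivAt (fun y : EuclideanSpace ℝ (Fin d) => ‖y‖ ^ 2) (2 • innerSL ℝ x) x :=
    (hasStrictFDerivAt_norm_sq x).hasFDerivAt
  have h2 : HasFDerivAt (radialParam R) ((2 * R + 1)⁻¹ • (2 • innerSL ℝ x)) x := by
    have := (h.sub_const (R ^ 2)).const_mul (2 * R + 1)⁻¹
    refine this.congr_of_eventuallyEq (Filter.Eventually.of_forall fun y => ?_)
    simp only [radialParam, div_eq_inv_mul]
  rw [pderiv_eq_of_hasFDerivAt i h2]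
  simp [EuclideanSpace.inner_single_right]
  ring

theorem lap_radialParam (R : ℝ) (x : EuclideanSpace ℝ (Fin d)) :
    lap (radialParam R) x = d * (2 / (2 * R + 1)) := by
  have h : ∀ i : Fin d, pderiv i (radialParam R) = fun y => 2 / (2 * R + 1) * y i :=
    fun i => funext (pderiv_radialParam R i)
  have h1 : ∀ i : Fin d, pderiv i (pderiv i (radialParam R)) x = 2 / (2 * R + 1) := by
    intro i
    rw [h, pderiv_const_mul i (by fun_prop), pderiv_coord]; simp
  simp [lap, h1]

theorem sum_sq_pderiv_radialParam (R : ℝ) (x : EuclideanSpace ℝ (Fin d)) :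
    ∑ i, pderiv i (radialParam R) x ^ 2 = (2 / (2 * R + 1)) ^ 2 * ‖x‖ ^ 2 := by
  simp only [pderiv_radialParam, mul_pow, ← Finset.mul_sum]
  rw [EuclideanSpace.real_norm_sq_eq]

theorem mem_annulus_iff {R R' : ℝ} {x : EuclideanSpace ℝ (Fin d)} :
    x ∈ annulus d R R' ↔ R < ‖x‖ ∧ ‖x‖ < R' := by
  simp [annulus, and_comm]

theorem measurableSet_annulus (R R' : ℝ) : MeasurableSet (annulus d R R') :=
  measurableSet_ball.diff measurableSet_closedBall

/-- Radial cutoff functions at unit scale: `χ` drops from `1` to `0` across the annulus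
`R < |x| < R + 1`, and `ζ` dominates `|∇χ|²`. The bounds do not depend on `R`. -/
theorem exists_radial_cutoff (d : ℕ) : ∃ C : ℝ, 0 ≤ C ∧ ∀ R : ℝ, 1 ≤ R →
    ∃ χ ζ : EuclideanSpace ℝ (Fin d) → ℝ, ContDiff ℝ ∞ χ ∧ ContDiff ℝ ∞ ζ ∧
      (∀ x, ‖x‖ ≤ R → χ x = 1) ∧ (∀ x, R + 1 ≤ ‖x‖ → χ x = 0) ∧
      (∀ x, ∑ i, pderiv i χ x ^ 2 ≤ 4 * ζ x) ∧ (∀ x, 0 ≤ ζ x) ∧ (∀ x, ζ x ≤ C) ∧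
      (∀ x, |lap χ x| ≤ C) ∧ (∀ x, |lap ζ x| ≤ C) ∧
      (∀ x, x ∉ annulus d R (R + 1) → ζ x = 0 ∧ lap χ x = 0 ∧ lap ζ x = 0) := by
  obtain ⟨g, C, hg, hgl, hgr, b1, b2, b3, b4⟩ := exists_cutoff_profile
  have hC : 0 ≤ C := (abs_nonneg _).trans (b1 0)
  refine ⟨C ^ 2 + C * (4 + 2 * d), by positivity, fun R hR => ?_⟩
  set s : EuclideanSpace ℝ (Fin d) → ℝ := radialParam R with hs
  have hsm : ContDiff ℝ ∞ s := contDiff_radialParam R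
  have hdg := hg.deriv_infty
  have hzg : ContDiff ℝ ∞ (fun t => deriv g t ^ 2) := by fun_prop
  have hR1 : 0 < 2 * R + 1 := by linarith
  have hsl : ∀ x, ‖x‖ ≤ R → s x ≤ 0 := fun x hx => by
    refine div_nonpos_of_nonpos_of_nonneg ?_ hR1.le
    nlinarith [norm_nonneg x]
  have hsr : ∀ x, R + 1 ≤ ‖x‖ → 1 ≤ s x := fun x hx => by
    rw [hs, radialParam, le_div_iff₀ hR1]
    nlinarith [norm_nonneg x]
  have hout : ∀ x, x ∉ annulus d R (R + 1) → s x < 1 / 4 ∨ 3 / 4 < s x := fun x hx => by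
    rw [mem_annulus_iff, not_and_or, not_lt, not_lt] at hx
    rcases hx with hx | hx
    · left; linarith [hsl x hx]
    · right; linarith [hsr x hx]
  have z1 := deriv_eq_zero_of_locally_const hgl hgr
  have z2 := deriv_eq_zero_of_locally_const (fun t ht => z1 t (.inl ht)) fun t ht => z1 t (.inr ht)
  have z3 : ∀ t, t < 1 / 4 ∨ 3 / 4 < t → deriv g t ^ 2 = 0 := fun t ht => by simp [z1 t ht]
  have z4 := deriv_eq_zero_of_locally_const (fun t ht => z3 t (.inl ht)) fun t ht => z3 t (.inr ht)
  have z5 := deriv_eq_zero_of_locally_const (fun t ht => z4 t (.inl ht)) fun t ht => z4 t (.inr ht)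
  -- An affine function of `‖x‖²` is smooth at the origin, and division by `2R + 1` keeps its
  -- gradient bounded near radius `R`.
  have hgrad : ∀ x, x ∈ annulus d R (R + 1) → ∑ i, pderiv i s x ^ 2 ≤ 4 := fun x hx => by
    rw [mem_annulus_iff] at hx
    rw [hs, sum_sq_pderiv_radialParam, ← mul_pow]
    have h1 : 2 / (2 * R + 1) * ‖x‖ ≤ 2 := by
      rw [div_mul_eq_mul_div, div_le_iff₀ hR1]; linarith
    have h0 : 0 ≤ 2 / (2 * R + 1) * ‖x‖ := by positivity
    nlinarith
  have hgrad0 : ∀ x, 0 ≤ ∑ i, pderiv i s x ^ 2 := fun x => Finset.sum_nonneg fun i _ => sq_nonneg _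
  have hlap : ∀ x, |lap s x| ≤ 2 * d := fun x => by
    rw [hs, lap_radialParam, abs_of_nonneg (by positivity), mul_comm]
    gcongr
    rw [div_le_iff₀ hR1]; linarith
  have key : ∀ h : ℝ → ℝ, ContDiff ℝ ∞ h → (∀ t, |deriv h t| ≤ C) → (∀ t, |deriv (deriv h) t| ≤ C) →
      (∀ t, t < 1 / 4 ∨ 3 / 4 < t → deriv h t = 0) →
      (∀ t, t < 1 / 4 ∨ 3 / 4 < t → deriv (deriv h) t = 0) →
      ∀ x, |lap (fun y => h (s y)) x| ≤ C ^ 2 + C * (4 + 2 * d) := by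
    intro h hh c1 c2 y1 y2 x
    rw [lap_comp hh hsm]
    by_cases hx : x ∈ annulus d R (R + 1)
    · calc _ ≤ |deriv (deriv h) (s x)| * |∑ i, pderiv i s x ^ 2| +
            |deriv h (s x)| * |lap s x| := by
              rw [← abs_mul, ← abs_mul]; exact abs_add_le _ _
        _ ≤ C * 4 + C * (2 * d) := by
            rw [abs_of_nonneg (hgrad0 x)]
            gcongr
            exacts [c2 _, hgrad x hx, c1 _, hlap x]
        _ ≤ _ := by nlinarith [sq_nonneg C]
    · rw [y1 _ (hout x hx), y2 _ (hout x hx)]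
      simp; positivity
  -- With `s = radialParam R`, `|∇χ|² = g'(s)² |∇s|²`. Taking `ζ = g'(s)²` gives a smooth majorant
  -- up to the factor 4, to which a Laplacian can be transferred.
  refine ⟨fun x => g (s x), fun x => deriv g (s x) ^ 2, by fun_prop, hzg.comp hsm, fun x hx => hgl _ (by linarith [hsl x hx]),
    fun x hx => hgr _ (by linarith [hsr x hx]), fun x => ?_, fun x => sq_nonneg _, fun x => ?_,
    key g hg b1 b2 z1 z2, key _ hzg b3 b4 z4 z5, fun x hx => ⟨z3 _ (hout x hx), ?_, ?_⟩⟩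
  · simp only [pderiv_comp _ hg hsm, mul_pow, ← Finset.mul_sum]
    by_cases hx : x ∈ annulus d R (R + 1)
    · rw [mul_comm]
      exact mul_le_mul_of_nonneg_right (hgrad x hx) (sq_nonneg _)
    · rw [z3 _ (hout x hx)]; simp
  · have : deriv g (s x) ^ 2 ≤ C ^ 2 := by
      rw [← sq_abs]; exact pow_le_pow_left₀ (abs_nonneg _) (b1 _) 2
    have : 0 ≤ C * (4 + 2 * (d : ℝ)) := by positivity
    dsimp only; linarith
  · rw [lap_comp hg hsm, z1 _ (hout x hx), z2 _ (hout x hx)]; simp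
  · rw [lap_comp hzg hsm, z4 _ (hout x hx), z5 _ (hout x hx)]; simp

end Cutoff

/-! ### Caccioppoli inequality and the cut-off Carleman estimate for smooth functions. -/

section Interior

variable {d : ℕ}

theorem Continuous.integrableOn_annulus {f : EuclideanSpace ℝ (Fin d) → ℝ} (hf : Continuous f)
    (R R' : ℝ) : IntegrableOn f (annulus d R R') :=
  (hf.continuousOn.integrableOn_compact (isCompact_closedBall 0 R')).mono_set
    fun _ hx => Metric.ball_subset_closedBall hx.1

/-- A Caccioppoli inequality: `Δ(u²) / 2 = |∇u|² + u Δu` integrated against a cutoff. -/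
theorem integral_cutoff_mul_grad_sq_le {R C : ℝ} {ζ u : EuclideanSpace ℝ (Fin d) → ℝ}
    (hζ : ContDiff ℝ ∞ ζ) (hζs : HasCompactSupport ζ) (hζ0 : ∀ x, 0 ≤ ζ x) (hζC : ∀ x, ζ x ≤ C)
    (hlap : ∀ x, |lap ζ x| ≤ C)
    (hout : ∀ x, x ∉ annulus d R (R + 1) → ζ x = 0 ∧ lap ζ x = 0) (hu : ContDiff ℝ ∞ u) :
    ∫ x, ζ x * ∑ i, pderiv i u x ^ 2 ≤
      C * ∫ x in annulus d R (R + 1), (u x ^ 2 + lap u x ^ 2) := by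
  have I : ∀ {f : EuclideanSpace ℝ (Fin d) → ℝ}, ContDiff ℝ ∞ f → HasCompactSupport f →
      Integrable f := fun hf hfs => hf.continuous.integrable_of_hasCompactSupport hfs
  have hG : ∀ x, lap (fun y => u y * u y) x = 2 * (u x * lap u x + ∑ i, pderiv i u x ^ 2) := by
    intro x
    rw [lap_mul hu hu]
    simp only [sq]
    ring
  have hpt : ∀ x, ζ x * ∑ i, pderiv i u x ^ 2 =
      ζ x * lap (fun y => u y * u y) x / 2 - ζ x * (u x * lap u x) := by
    intro x; rw [hG]; ring
  have hcomm := integral_mul_lap_comm hζ (hu.mul hu) hζs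
  have i1 : Integrable fun x => ζ x * lap (fun y => u y * u y) x / 2 := by
    exact Integrable.div_const (I (f := fun x => ζ x * lap (fun y => u y * u y) x)
      (by fun_prop) hζs.mul_right) 2
  have i2 : Integrable fun x => ζ x * (u x * lap u x) := I (by fun_prop) hζs.mul_right
  have i3 : Integrable fun x => lap ζ x * (u x * u x) / 2 :=
    Integrable.div_const (I (f := fun x => lap ζ x * (u x * u x))
      (by fun_prop) hζs.lap.mul_right) 2
  calc ∫ x, ζ x * ∑ i, pderiv i u x ^ 2
      = ∫ x, (lap ζ x * (u x * u x) / 2 - ζ x * (u x * lap u x)) := by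
        simp only [hpt]
        rw [integral_sub i1 i2, integral_sub i3 i2, integral_div, integral_div, hcomm]
    _ ≤ ∫ x, (annulus d R (R + 1)).indicator (fun x => C * (u x ^ 2 + lap u x ^ 2)) x := by
        refine integral_mono (i3.sub i2) ?_ fun x => ?_
        · rw [integrable_indicator_iff (measurableSet_annulus _ _)]
          exact Continuous.integrableOn_annulus
            (continuous_const.mul ((hu.continuous.pow 2).add (hu.lap.continuous.pow 2))) _ _
        · by_cases hx : x ∈ annulus d R (R + 1)
          · rw [Set.indicator_of_mem hx]
            have hC : 0 ≤ C := (hζ0 x).trans (hζC x)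
            have h1 : lap ζ x * (u x * u x) ≤ C * u x ^ 2 := by
              rw [sq]
              exact mul_le_mul_of_nonneg_right (le_of_abs_le (hlap x)) (mul_self_nonneg _)
            have h2 : -(u x * lap u x) ≤ (u x ^ 2 + lap u x ^ 2) / 2 := by
              nlinarith [sq_nonneg (u x + lap u x)]
            have h3 : ζ x * -(u x * lap u x) ≤ C * ((u x ^ 2 + lap u x ^ 2) / 2) :=
              (mul_le_mul_of_nonneg_left h2 (hζ0 x)).trans
                (mul_le_mul_of_nonneg_right (hζC x) (by positivity))
            have h4 : 0 ≤ C * lap u x ^ 2 := by positivity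
            dsimp only
            linarith
          · rw [Set.indicator_of_notMem hx]
            simp [hout x hx]
    _ = _ := by
        rw [integral_indicator (measurableSet_annulus _ _), integral_const_mul]

/-- The Carleman estimate applied to a cut-off of a smooth function. The constant `C` depends on
the dimension only. -/
theorem exists_carleman_cutoff (hd : 1 ≤ d) : ∃ C : ℝ, 0 ≤ C ∧ ∀ R : ℝ, 1 ≤ R →
    ∀ a : ℝ, 0 ≤ a → ∃ m : EuclideanSpace ℝ (Fin d) → ℝ, Continuous m ∧ HasCompactSupport m ∧
      (∀ x, ‖x‖ ≤ R → 1 ≤ m x ^ 2) ∧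
      ∀ u : EuclideanSpace ℝ (Fin d) → ℝ, ContDiff ℝ ∞ u →
        8 * a ^ 3 * (R + 1) ^ 2 * ∫ x, (m x * u x) ^ 2 ≤
          2 * (∫ x, (m x * lap u x) ^ 2) + C * Real.exp (9 * a * (R + 1) ^ 2) *
            ∫ x in annulus d R (R + 1), (u x ^ 2 + lap u x ^ 2) := by
  obtain ⟨C, hC0, hcut⟩ := exists_radial_cutoff d
  -- `64C` comes from the gradient term through Caccioppoli and `4C²` from `u Δχ`; `64C²` is slack.
  refine ⟨64 * C + 4 * C ^ 2 + 64 * C ^ 2, by positivity, fun R hR a ha => ?_⟩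
  obtain ⟨χ, ζ, hχ, hζ, χin, χout, hgrad, ζ0, ζC, lχ, lζ, hout⟩ := hcut R hR
  set k : Fin d := ⟨0, hd⟩
  set b : ℝ := 2 * (R + 1) with hb
  set φ := carlemanWeight k a b with hφ
  have hφsm : ContDiff ℝ ∞ φ := contDiff_carlemanWeight k a b
  have hK : IsCompact (Metric.closedBall (0 : EuclideanSpace ℝ (Fin d)) (R + 1)) :=
    isCompact_closedBall 0 (R + 1)
  have hχs : HasCompactSupport χ := HasCompactSupport.intro hK fun x hx =>
    χout x (by simpa using (not_le.1 (mt mem_closedBall_zero_iff.2 hx)).le)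
  have hζs : HasCompactSupport ζ := HasCompactSupport.intro hK fun x hx =>
    (hout x fun hxa => hx (Metric.ball_subset_closedBall hxa.1)).1
  have I : ∀ {f : EuclideanSpace ℝ (Fin d) → ℝ}, ContDiff ℝ ∞ f → HasCompactSupport f →
      Integrable f := fun hf hfs => hf.continuous.integrable_of_hasCompactSupport hfs
  -- The multiplier `m = e^φ χ` is independent of `u`, continuous and compactly supported, hence
  -- bounded, which later allows passage to `L²` limits.
  refine ⟨fun x => Real.exp (φ x) * χ x, by fun_prop, hχs.mul_left, fun x hx => ?_, fun u hu => ?_⟩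
  · dsimp only
    rw [χin x hx, mul_one]
    refine one_le_pow₀ (Real.one_le_exp ?_)
    rw [hφ, carlemanWeight]; positivity
  have hcoord : ∀ x : EuclideanSpace ℝ (Fin d), ‖x‖ ≤ R + 1 → R + 1 ≤ x k + b ∧
      x k + b ≤ 3 * (R + 1) := fun x hx => by
    have h1 : |x k| ≤ R + 1 := by
      have := PiLp.norm_apply_le x k
      rw [Real.norm_eq_abs] at this
      exact this.trans hx
    rw [abs_le] at h1
    constructor <;> linarith [h1.1, h1.2]
  set A := annulus d R (R + 1) with hA
  set w : EuclideanSpace ℝ (Fin d) → ℝ := fun x => χ x * u x with hw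
  have hwsm : ContDiff ℝ ∞ w := hχ.mul hu
  have hws : HasCompactSupport w := hχs.mul_right
  have hcarl := carleman_estimate k ha b hwsm hws
  have hW : ∀ x : EuclideanSpace ℝ (Fin d), ‖x‖ ≤ R + 1 →
      Real.exp (φ x) ^ 2 ≤ Real.exp (9 * a * (R + 1) ^ 2) := fun x hx => by
    rw [← Real.exp_nat_mul]
    apply Real.exp_le_exp.2
    obtain ⟨h1, h2⟩ := hcoord x hx
    have h3 : (x k + b) ^ 2 ≤ (3 * (R + 1)) ^ 2 := pow_le_pow_left₀ (by linarith) h2 2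
    have h4 := mul_le_mul_of_nonneg_left h3 ha
    rw [hφ, carlemanWeight]
    push_cast
    nlinarith
  set W := Real.exp (9 * a * (R + 1) ^ 2) with hWdef
  have hW0 : 0 < W := Real.exp_pos _
  have hlower : 8 * a ^ 3 * (R + 1) ^ 2 * ∫ x, (Real.exp (φ x) * χ x * u x) ^ 2 ≤
      ∫ x, 8 * a * affineCoord k a b x ^ 2 * (Real.exp (φ x) * w x) ^ 2 := by
    rw [← integral_const_mul]
    refine integral_mono (I (by fun_prop) ?_) (I (by fun_prop) ?_) fun x => ?_
    · simp only [sq (_ * u _)]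
      exact HasCompactSupport.mul_left hχs.mul_left.mul_right.mul_right
    · simp only [sq (_ * w _)]
      exact HasCompactSupport.mul_left hws.mul_left.mul_right
    · have e : Real.exp (φ x) * w x = Real.exp (φ x) * χ x * u x := by rw [hw]; ring
      dsimp only
      rw [e]
      rcases le_or_gt ‖x‖ (R + 1) with hx | hx
      · refine mul_le_mul_of_nonneg_right ?_ (sq_nonneg _)
        have h1 : (R + 1) ^ 2 ≤ (x k + b) ^ 2 := pow_le_pow_left₀ (by linarith) (hcoord x hx).1 2
        have h2 := mul_le_mul_of_nonneg_left h1 (by positivity : 0 ≤ 8 * a ^ 3)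
        rw [affineCoord]
        nlinarith
      · rw [χout x hx.le]; simp
  have hpt : ∀ x, (Real.exp (φ x) * lap w x) ^ 2 ≤ 2 * (Real.exp (φ x) * χ x * lap u x) ^ 2 +
      (64 * W * (ζ x * ∑ i, pderiv i u x ^ 2) + A.indicator (fun x => 4 * C ^ 2 * W * u x ^ 2) x) := by
    intro x
    rw [hw, lap_mul hχ hu]
    set P := ∑ i, pderiv i χ x * pderiv i u x with hP
    -- Cauchy–Schwarz with `|∇χ|² ≤ 4ζ`. Outside the annulus `ζ = 0`, so this also forces the cross
    -- term to vanish there.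
    have cs : P ^ 2 ≤ 4 * ζ x * ∑ i, pderiv i u x ^ 2 :=
      (Finset.sum_mul_sq_le_sq_mul_sq _ _ _).trans
        (mul_le_mul_of_nonneg_right (hgrad x) (Finset.sum_nonneg fun i _ => sq_nonneg _))
    -- Two uses of `(α + β)² ≤ 2α² + 2β²`. The coefficient 2 on the main term must stay below the 8
    -- of the Carleman estimate for the absorption.
    have hsq : (χ x * lap u x + 2 * P + u x * lap χ x) ^ 2 ≤
        2 * (χ x * lap u x) ^ 2 + (16 * P ^ 2 + 4 * (u x * lap χ x) ^ 2) := by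
      nlinarith [sq_nonneg (χ x * lap u x - (2 * P + u x * lap χ x)),
        sq_nonneg (2 * P - u x * lap χ x)]
    by_cases hx : x ∈ A
    · rw [Set.indicator_of_mem hx]
      have hxR : ‖x‖ ≤ R + 1 := (mem_annulus_iff.1 hx).2.le
      have hl : lap χ x ^ 2 ≤ C ^ 2 := by
        rw [← sq_abs]; exact pow_le_pow_left₀ (abs_nonneg _) (lχ x) 2
      have h1 : 16 * P ^ 2 + 4 * (u x * lap χ x) ^ 2 ≤
          64 * (ζ x * ∑ i, pderiv i u x ^ 2) + 4 * C ^ 2 * u x ^ 2 := by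
        have := mul_le_mul_of_nonneg_left hl (sq_nonneg (u x))
        rw [mul_pow]
        linarith
      have h2 : 0 ≤ 16 * P ^ 2 + 4 * (u x * lap χ x) ^ 2 := by positivity
      have h3 := mul_le_mul (hW x hxR) h1 h2 hW0.le
      have h4 := mul_le_mul_of_nonneg_left hsq (sq_nonneg (Real.exp (φ x)))
      calc _ = Real.exp (φ x) ^ 2 * (χ x * lap u x + 2 * P + u x * lap χ x) ^ 2 := by ring
        _ ≤ _ := h4
        _ = 2 * (Real.exp (φ x) * χ x * lap u x) ^ 2 +
            Real.exp (φ x) ^ 2 * (16 * P ^ 2 + 4 * (u x * lap χ x) ^ 2) := by ring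
        _ ≤ _ := by linarith
    · obtain ⟨y1, y2, -⟩ := hout x hx
      rw [Set.indicator_of_notMem hx, y1, y2]
      rw [y1] at cs
      rw [y2] at hsq
      have h1 : (χ x * lap u x + 2 * P + u x * 0) ^ 2 ≤ 2 * (χ x * lap u x) ^ 2 := by
        linarith
      have h4 := mul_le_mul_of_nonneg_left h1 (sq_nonneg (Real.exp (φ x)))
      calc _ = Real.exp (φ x) ^ 2 * (χ x * lap u x + 2 * P + u x * 0) ^ 2 := by ring
        _ ≤ _ := h4
        _ = _ := by ring
  have j1 : Integrable fun x => (Real.exp (φ x) * χ x * lap u x) ^ 2 := by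
    refine I (by fun_prop) ?_
    simp only [sq]
    exact hχs.mul_left.mul_right.mul_right
  have j2 : Integrable fun x => ζ x * ∑ i, pderiv i u x ^ 2 := I (by fun_prop) hζs.mul_right
  have cu := hu.continuous
  have clu := hu.lap.continuous
  have j3 : Integrable (A.indicator (fun x => 4 * C ^ 2 * W * u x ^ 2)) := by
    rw [integrable_indicator_iff (measurableSet_annulus _ _)]
    exact Continuous.integrableOn_annulus (by fun_prop) _ _
  have j4 : Integrable fun x => (Real.exp (φ x) * lap w x) ^ 2 := by
    refine I (by fun_prop) ?_
    simp only [sq]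
    exact hws.lap.mul_left.mul_right
  have j5 : Integrable fun x => 64 * W * (ζ x * ∑ i, pderiv i u x ^ 2) +
      A.indicator (fun x => 4 * C ^ 2 * W * u x ^ 2) x := (j2.const_mul _).add j3
  have hcacc := integral_cutoff_mul_grad_sq_le hζ hζs ζ0 ζC lζ
    (fun x hx => ⟨(hout x hx).1, (hout x hx).2.2⟩) hu
  have hA1 : ∫ x in A, u x ^ 2 ≤ ∫ x in A, (u x ^ 2 + lap u x ^ 2) := by
    refine integral_mono (Continuous.integrableOn_annulus (by fun_prop) _ _)
      (Continuous.integrableOn_annulus (by fun_prop) _ _) fun x => ?_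
    have := sq_nonneg (lap u x)
    dsimp only
    linarith
  have hA0 : 0 ≤ ∫ x in A, (u x ^ 2 + lap u x ^ 2) := integral_nonneg fun x => by positivity
  have hupper := integral_mono j4 ((j1.const_mul 2).add j5) hpt
  simp only [Pi.add_apply] at hupper
  rw [integral_add (j1.const_mul 2) j5, integral_add (j2.const_mul _) j3, integral_const_mul 2,
    integral_const_mul (64 * W), integral_indicator (measurableSet_annulus _ _),
    integral_const_mul] at hupper
  refine hlower.trans (hcarl.trans (hupper.trans ?_))
  have t1 := mul_le_mul_of_nonneg_left hcacc (by positivity : 0 ≤ 64 * W)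
  have t2 := mul_le_mul_of_nonneg_left hA1 (by positivity : 0 ≤ 4 * C ^ 2 * W)
  have t3 : 0 ≤ 64 * C ^ 2 * W * ∫ x in A, (u x ^ 2 + lap u x ^ 2) := by positivity
  linarith

end Interior

/-! ### Smooth approximation of weak `L²` solutions of `ΔU = F`. -/

section Mollification

open Filter Topology

theorem eLpNorm_two_sq {α : Type*} {m : MeasurableSpace α} {μ : Measure α} (f : α → ℝ) :
    eLpNorm f 2 μ ^ 2 = ∫⁻ x, ‖f x‖ₑ ^ 2 ∂μ := by
  have h := eLpNorm_nnreal_pow_eq_lintegral (f := f) (μ := μ) (p := 2) (by norm_num)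
  simpa using h

variable {d : ℕ} {U F : EuclideanSpace ℝ (Fin d) → ℝ}

/-- Translations are continuous in `L²`. -/
theorem exists_eLpNorm_translate_sub_le (hU : MemLp U 2) {ε : ℝ≥0∞} (hε : 0 < ε) :
    ∃ δ : ℝ, 0 < δ ∧ ∀ y : EuclideanSpace ℝ (Fin d), ‖y‖ < δ →
      eLpNorm (fun x => U (y + x) - U x) 2 ≤ ε := by
  set f := hU.toLp U with hf
  have hc : Continuous fun y : EuclideanSpace ℝ (Fin d) => DomAddAct.mk y +ᵥ f := by
    have h1 : Continuous (DomAddAct.mk : EuclideanSpace ℝ (Fin d) → _) :=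
      DomAddAct.mkHomeomorph.continuous
    have : Fact ((2 : ℝ≥0∞) ≠ ⊤) := ⟨by norm_num⟩
    exact h1.vadd continuous_const
  have ht : Tendsto (fun y : EuclideanSpace ℝ (Fin d) => DomAddAct.mk y +ᵥ f) (𝓝 0) (𝓝 f) := by
    have h := hc.tendsto 0
    simpa using h
  have hev := (EMetric.tendsto_nhds.1 ht) ε hε
  obtain ⟨δ, hδ, hball⟩ := Metric.eventually_nhds_iff.1 hev
  refine ⟨δ, hδ, fun y hy => ?_⟩
  have h1 := (hball (by simpa using hy : dist y 0 < δ)).le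
  rw [Lp.edist_def] at h1
  refine le_trans (le_of_eq ?_) h1
  refine eLpNorm_congr_ae ?_
  have hq : MeasurePreserving (fun x : EuclideanSpace ℝ (Fin d) => y + x) volume volume :=
    measurePreserving_add_left volume y
  have e2 : ∀ᵐ x, f (y + x) = U (y + x) := hq.quasiMeasurePreserving.ae hU.coeFn_toLp
  filter_upwards [DomAddAct.vadd_Lp_ae_eq (DomAddAct.mk y) f, hU.coeFn_toLp, e2] with x a1 a2 a3
  simp only [Pi.sub_apply]
  rw [a1, a2]
  simp [a3]

/-- A mollification differs in `L²` from the original function by at most the largest translation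
error over the support of the mollifier. -/
theorem eLpNorm_convolution_sub_le (hUm : Measurable U) (hU : MemLp U 2)
    {ρ : EuclideanSpace ℝ (Fin d) → ℝ} (hρ : Continuous ρ) (hρs : HasCompactSupport ρ)
    (hρ0 : ∀ x, 0 ≤ ρ x) (hρ1 : ∫ x, ρ x = 1) {r : ℝ} (hr : ∀ x, r ≤ ‖x‖ → ρ x = 0) {ε : ℝ≥0∞}
    (hε : ∀ y : EuclideanSpace ℝ (Fin d), ‖y‖ < r → eLpNorm (fun x => U (y + x) - U x) 2 ≤ ε) :
    eLpNorm (fun x => convolution ρ U (ContinuousLinearMap.mul ℝ ℝ) volume x - U x) 2 ≤ ε := by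
  -- With `ρ dy` as a probability measure, the error is an average of translation errors. Jensen's
  -- inequality and Tonelli then bound its `L²` norm.
  set ν : Measure (EuclideanSpace ℝ (Fin d)) := volume.withDensity fun y => ENNReal.ofReal (ρ y)
    with hν
  have hρm : Measurable fun y => ENNReal.ofReal (ρ y) := hρ.measurable.ennreal_ofReal
  have hρi : Integrable ρ := hρ.integrable_of_hasCompactSupport hρs
  have hprob : IsProbabilityMeasure ν := ⟨by
    rw [hν, withDensity_apply _ MeasurableSet.univ, Measure.restrict_univ,
      ← ofReal_integral_eq_lintegral_ofReal hρi (Eventually.of_forall hρ0), hρ1,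
      ENNReal.ofReal_one]⟩
  have hloc : LocallyIntegrable U := hU.locallyIntegrable (by norm_num)
  have hconv : ∀ x, Integrable (fun y => ρ y * U (x - y)) := fun x =>
    (hρs.convolutionExists_left (ContinuousLinearMap.mul ℝ ℝ) hρ hloc x).integrable
  have hrepr : ∀ x, convolution ρ U (ContinuousLinearMap.mul ℝ ℝ) volume x - U x =
      ∫ y, (U (x - y) - U x) ∂ν := by
    intro x
    rw [hν, integral_withDensity_eq_integral_toReal_smul hρm
      (Eventually.of_forall fun _ => ENNReal.ofReal_lt_top)]
    simp only [ENNReal.toReal_ofReal (hρ0 _), smul_eq_mul, mul_sub]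
    rw [integral_sub (hconv x) (hρi.mul_const _), integral_mul_const, hρ1, one_mul]
    rfl
  have hmeas : Measurable (Function.uncurry fun x y : EuclideanSpace ℝ (Fin d) =>
      ‖U (x - y) - U x‖ₑ ^ 2) := by
    have : Measurable fun q : EuclideanSpace ℝ (Fin d) × EuclideanSpace ℝ (Fin d) =>
      ‖U (q.1 - q.2) - U q.1‖ₑ ^ 2 := by fun_prop
    exact this
  have hpt : ∀ x, ‖convolution ρ U (ContinuousLinearMap.mul ℝ ℝ) volume x - U x‖ₑ ^ 2 ≤
      ∫⁻ y, ‖U (x - y) - U x‖ₑ ^ 2 ∂ν := by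
    intro x
    rw [hrepr, ← eLpNorm_two_sq]
    gcongr
    refine (enorm_integral_le_lintegral_enorm _).trans ?_
    rw [← eLpNorm_one_eq_lintegral_enorm]
    refine eLpNorm_le_eLpNorm_of_exponent_le (by norm_num) ?_
    exact Measurable.aestronglyMeasurable (by fun_prop)
  have hsq : eLpNorm (fun x => convolution ρ U (ContinuousLinearMap.mul ℝ ℝ) volume x - U x) 2 ^ 2
      ≤ ε ^ 2 := by
    rw [eLpNorm_two_sq]
    calc _ ≤ ∫⁻ x, ∫⁻ y, ‖U (x - y) - U x‖ₑ ^ 2 ∂ν := lintegral_mono hpt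
      _ = ∫⁻ y, (∫⁻ x, ‖U (x - y) - U x‖ₑ ^ 2) ∂ν := lintegral_lintegral_swap hmeas.aemeasurable
      _ ≤ ∫⁻ _, ε ^ 2 ∂ν := by
        refine lintegral_mono_ae ?_
        rw [hν, ae_withDensity_iff hρm]
        refine Eventually.of_forall fun y hy => ?_
        have hyr : ‖y‖ < r := by
          by_contra hcon
          exact hy (by rw [hr y (not_lt.1 hcon), ENNReal.ofReal_zero])
        have h1 := hε (-y) (by simpa using hyr)
        rw [← eLpNorm_two_sq fun x => U (x - y) - U x]
        gcongr
        simpa only [neg_add_eq_sub] using h1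
      _ = ε ^ 2 := by simp
  exact (ENNReal.pow_le_pow_left_iff two_ne_zero).1 hsq

theorem pderiv_reflect (i : Fin d) {f : EuclideanSpace ℝ (Fin d) → ℝ} (hf : ContDiff ℝ ∞ f) (x t) :
    pderiv i (fun t => f (x - t)) t = -pderiv i f (x - t) := by
  have h := (hf.hasFDerivAt_infty (x - t)).comp t ((hasFDerivAt_id t).const_sub x)
  rw [pderiv_eq_of_hasFDerivAt i (f := fun t => f (x - t)) h]
  simp [pderiv]

theorem lap_reflect {f : EuclideanSpace ℝ (Fin d) → ℝ} (hf : ContDiff ℝ ∞ f) (x t) :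
    lap (fun t => f (x - t)) t = lap f (x - t) := by
  refine Finset.sum_congr rfl fun i _ => ?_
  have h : pderiv i (fun t => f (x - t)) = fun t => (-1) * pderiv i f (x - t) := by
    funext t; rw [pderiv_reflect i hf]; ring
  rw [h, pderiv_const_mul i (by fun_prop), pderiv_reflect i (by fun_prop)]
  ring

theorem pderiv_convolution (i : Fin d) (hU : LocallyIntegrable U)
    {ρ : EuclideanSpace ℝ (Fin d) → ℝ} (hρ : ContDiff ℝ ∞ ρ) (hρs : HasCompactSupport ρ) :
    pderiv i (convolution U ρ (ContinuousLinearMap.mul ℝ ℝ) volume) =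
      convolution U (pderiv i ρ) (ContinuousLinearMap.mul ℝ ℝ) volume := by
  funext x
  have h := hρs.hasFDerivAt_convolution_right (μ := volume) (ContinuousLinearMap.mul ℝ ℝ) hU
    (hρ.of_le (by simp)) x
  rw [pderiv_eq_of_hasFDerivAt i h, convolution_precompR_apply _ hU (hρs.fderiv ℝ)
    (hρ.continuous_fderiv (by simp))]
  rfl

/-- A weak equation `ΔU = F` holds classically for mollifications. -/
theorem lap_convolution (hU : LocallyIntegrable U)
    (hUF : ∀ φ : EuclideanSpace ℝ (Fin d) → ℝ, ContDiff ℝ ∞ φ → HasCompactSupport φ →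
      ∫ x, U x * lap φ x = ∫ x, F x * φ x)
    {ρ : EuclideanSpace ℝ (Fin d) → ℝ} (hρ : ContDiff ℝ ∞ ρ) (hρs : HasCompactSupport ρ) :
    lap (convolution U ρ (ContinuousLinearMap.mul ℝ ℝ) volume) =
      convolution F ρ (ContinuousLinearMap.mul ℝ ℝ) volume := by
  funext x
  have hcomp : ∀ {f : EuclideanSpace ℝ (Fin d) → ℝ}, HasCompactSupport f →
      HasCompactSupport fun t => f (x - t) := fun hf =>
    hf.comp_homeomorph (Homeomorph.subLeft x)
  have hsum : lap (convolution U ρ (ContinuousLinearMap.mul ℝ ℝ) volume) x =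
      ∫ t, U t * lap ρ (x - t) := by
    simp only [lap, pderiv_convolution _ hU hρ hρs, Finset.mul_sum]
    rw [integral_finsetSum]
    · refine Finset.sum_congr rfl fun i _ => ?_
      rw [pderiv_convolution i hU (hρ.pderiv i) (hρs.pderiv i)]
      rfl
    · intro i _
      exact ((hρs.pderiv i).pderiv i).convolutionExists_right (ContinuousLinearMap.mul ℝ ℝ) hU
        ((hρ.pderiv i).pderiv i).continuous x
  rw [hsum]
  -- The reflected and translated mollifier is itself a test function, and reflection leaves the
  -- Laplacian's sign unchanged.
  have h := hUF (fun t => ρ (x - t)) (by fun_prop) (hcomp hρs)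
  simp only [lap_reflect hρ] at h
  exact h

/-- If `ΔU = F` weakly with `U, F ∈ L²`, then `(U, F)` is an `L²` limit of `(w, Δw)` with `w`
smooth. -/
theorem exists_smooth_approx (hUm : Measurable U) (hU : MemLp U 2) (hFm : Measurable F)
    (hF : MemLp F 2) (hUF : ∀ φ : EuclideanSpace ℝ (Fin d) → ℝ, ContDiff ℝ ∞ φ →
      HasCompactSupport φ → ∫ x, U x * lap φ x = ∫ x, F x * φ x) :
    ∃ w : ℕ → EuclideanSpace ℝ (Fin d) → ℝ, (∀ n, ContDiff ℝ ∞ (w n)) ∧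
      Tendsto (fun n => eLpNorm (fun x => w n x - U x) 2 volume) atTop (𝓝 0) ∧
      Tendsto (fun n => eLpNorm (fun x => lap (w n) x - F x) 2 volume) atTop (𝓝 0) := by
  have hstep : ∀ n : ℕ, ∃ w : EuclideanSpace ℝ (Fin d) → ℝ, ContDiff ℝ ∞ w ∧
      eLpNorm (fun x => w x - U x) 2 volume ≤ (n + 1 : ℝ≥0∞)⁻¹ ∧
      eLpNorm (fun x => lap w x - F x) 2 volume ≤ (n + 1 : ℝ≥0∞)⁻¹ := by
    intro n
    have hε : (0 : ℝ≥0∞) < (n + 1 : ℝ≥0∞)⁻¹ := by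
      rw [ENNReal.inv_pos]
      exact ENNReal.add_ne_top.2 ⟨ENNReal.natCast_ne_top n, ENNReal.one_ne_top⟩
    obtain ⟨δ₁, hδ₁, h1⟩ := exists_eLpNorm_translate_sub_le hU hε
    obtain ⟨δ₂, hδ₂, h2⟩ := exists_eLpNorm_translate_sub_le hF hε
    have hδ : 0 < min δ₁ δ₂ := lt_min hδ₁ hδ₂
    -- A single mollifier serves for both `U` and `F`, since the approximating function and its
    -- Laplacian must come from the same `w`.
    let bump : ContDiffBump (0 : EuclideanSpace ℝ (Fin d)) :=
      ⟨min δ₁ δ₂ / 2, min δ₁ δ₂, by positivity, by linarith⟩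
    set ρ := bump.normed volume with hρdef
    have hρ : ContDiff ℝ ∞ ρ := bump.contDiff_normed
    have hρs : HasCompactSupport ρ := bump.hasCompactSupport_normed
    have hr : ∀ x, min δ₁ δ₂ ≤ ‖x‖ → ρ x = 0 := by
      intro x hx
      have : x ∉ Function.support ρ := by
        rw [hρdef, bump.support_normed_eq, mem_ball_zero_iff]
        exact not_lt.2 hx
      simpa using this
    have hloc : LocallyIntegrable U := hU.locallyIntegrable (by norm_num)
    have hflip : ∀ G : EuclideanSpace ℝ (Fin d) → ℝ,
        convolution G ρ (ContinuousLinearMap.mul ℝ ℝ) volume =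
          convolution ρ G (ContinuousLinearMap.mul ℝ ℝ) volume := by
      intro G
      rw [← convolution_flip]
      congr 1
      ext
      simp
    refine ⟨convolution U ρ (ContinuousLinearMap.mul ℝ ℝ) volume,
      hρs.contDiff_convolution_right _ hloc hρ, ?_, ?_⟩
    · rw [hflip]
      exact eLpNorm_convolution_sub_le hUm hU hρ.continuous hρs (fun x => bump.nonneg_normed x)
        bump.integral_normed hr fun y hy => h1 y (hy.trans_le (min_le_left _ _))
    · rw [lap_convolution hloc hUF hρ hρs, hflip]
      exact eLpNorm_convolution_sub_le hFm hF hρ.continuous hρs (fun x => bump.nonneg_normed x)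
        bump.integral_normed hr fun y hy => h2 y (hy.trans_le (min_le_right _ _))
  choose w hw h1 h2 using hstep
  have hlim : Tendsto (fun n : ℕ => (n + 1 : ℝ≥0∞)⁻¹) atTop (𝓝 0) := by
    have := (tendsto_add_atTop_iff_nat 1).2 ENNReal.tendsto_inv_nat_nhds_zero
    simpa using this
  exact ⟨w, hw, tendsto_of_tendsto_of_tendsto_of_le_of_le tendsto_const_nhds hlim
      (fun _ => zero_le) h1,
    tendsto_of_tendsto_of_tendsto_of_le_of_le tendsto_const_nhds hlim (fun _ => zero_le) h2⟩

theorem integral_sq_eq_eLpNorm {α : Type*} {m : MeasurableSpace α} {μ : Measure α} {f : α → ℝ}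
    (hf : AEStronglyMeasurable f μ) : ∫ x, f x ^ 2 ∂μ = (eLpNorm f 2 μ).toReal ^ 2 := by
  rw [← ENNReal.toReal_pow, eLpNorm_two_sq,
    integral_eq_lintegral_of_nonneg_ae (Eventually.of_forall fun x => sq_nonneg _) (hf.pow 2)]
  congr 1
  refine lintegral_congr fun x => ?_
  rw [← ofReal_norm, ← ENNReal.ofReal_pow (norm_nonneg _), Real.norm_eq_abs, sq_abs]

/-- The triangle inequality squeezes the norms of `f n` from both sides; stated for a general
measure, it covers both the weighted integrals over the whole space and those over the annulus. -/
theorem tendsto_integral_sq_of_eLpNorm {α : Type*} {m : MeasurableSpace α} {μ : Measure α}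
    {f : ℕ → α → ℝ} {g : α → ℝ} (hf : ∀ n, AEStronglyMeasurable (f n) μ) (hg : MemLp g 2 μ)
    (h : Tendsto (fun n => eLpNorm (fun x => f n x - g x) 2 μ) atTop (𝓝 0)) :
    Tendsto (fun n => ∫ x, f n x ^ 2 ∂μ) atTop (𝓝 (∫ x, g x ^ 2 ∂μ)) := by
  simp only [fun n => integral_sq_eq_eLpNorm (hf n), integral_sq_eq_eLpNorm hg.1]
  refine Tendsto.pow ?_ 2
  refine (ENNReal.tendsto_toReal hg.2.ne).comp ?_
  have hup : ∀ n, eLpNorm (f n) 2 μ ≤ eLpNorm g 2 μ + eLpNorm (fun x => f n x - g x) 2 μ := by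
    intro n
    have := eLpNorm_add_le hg.1 ((hf n).sub hg.1) (by norm_num : (1 : ℝ≥0∞) ≤ 2)
    rw [add_sub_cancel] at this
    exact this
  have hlow : ∀ n, eLpNorm g 2 μ - eLpNorm (fun x => f n x - g x) 2 μ ≤ eLpNorm (f n) 2 μ := by
    intro n
    rw [tsub_le_iff_right]
    have := eLpNorm_sub_le (hf n) ((hf n).sub hg.1) (by norm_num : (1 : ℝ≥0∞) ≤ 2)
    rw [sub_sub_cancel] at this
    exact this
  refine tendsto_of_tendsto_of_tendsto_of_le_of_le ?_ ?_ hlow hup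
  · simpa using ENNReal.Tendsto.sub tendsto_const_nhds h (.inl hg.2.ne)
  · simpa using tendsto_const_nhds.add h

end Mollification

/-! ### From weak solutions to the lower bound. -/

section Main

open Filter Topology

variable {d : ℕ}

/-- The cut-off Carleman estimate for weak `L²` solutions of `ΔU = F`. -/
theorem exists_carleman_cutoff_weak (hd : 1 ≤ d) : ∃ C : ℝ, 0 ≤ C ∧ ∀ R : ℝ, 1 ≤ R →
    ∀ a : ℝ, 0 ≤ a → ∃ m : EuclideanSpace ℝ (Fin d) → ℝ, Continuous m ∧ HasCompactSupport m ∧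
      (∀ x, ‖x‖ ≤ R → 1 ≤ m x ^ 2) ∧
      ∀ U F : EuclideanSpace ℝ (Fin d) → ℝ, Measurable U → MemLp U 2 → Measurable F → MemLp F 2 →
        (∀ φ : EuclideanSpace ℝ (Fin d) → ℝ, ContDiff ℝ ∞ φ → HasCompactSupport φ →
          ∫ x, U x * lap φ x = ∫ x, F x * φ x) →
        8 * a ^ 3 * (R + 1) ^ 2 * ∫ x, (m x * U x) ^ 2 ≤
          2 * (∫ x, (m x * F x) ^ 2) + C * Real.exp (9 * a * (R + 1) ^ 2) *
            ((∫ x in annulus d R (R + 1), U x ^ 2) + ∫ x in annulus d R (R + 1), F x ^ 2) := by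
  obtain ⟨C, hC, h⟩ := exists_carleman_cutoff hd
  refine ⟨C, hC, fun R hR a ha => ?_⟩
  obtain ⟨m, hm, hms, hm1, hsmooth⟩ := h R hR a ha
  refine ⟨m, hm, hms, hm1, fun U F hUm hU hFm hF hUF => ?_⟩
  obtain ⟨w, hw, hwU, hwF⟩ := exists_smooth_approx hUm hU hFm hF hUF
  obtain ⟨B, hB⟩ := hms.exists_bound_of_continuous hm
  have hmul : ∀ {f : ℕ → EuclideanSpace ℝ (Fin d) → ℝ} {g : EuclideanSpace ℝ (Fin d) → ℝ},
      (∀ n, Continuous (f n)) → MemLp g 2 →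
      Tendsto (fun n => eLpNorm (fun x => f n x - g x) 2 volume) atTop (𝓝 0) →
      Tendsto (fun n => ∫ x, (m x * f n x) ^ 2) atTop (𝓝 (∫ x, (m x * g x) ^ 2)) := by
    intro f g hf hg hfg
    refine tendsto_integral_sq_of_eLpNorm
      (fun n => (hm.mul (hf n)).aestronglyMeasurable) ?_ ?_
    · exact hg.of_le_mul (c := B) (hm.aestronglyMeasurable.mul hg.1)
        (Eventually.of_forall fun x => by
          rw [norm_mul]; exact mul_le_mul_of_nonneg_right (hB x) (norm_nonneg _))
    · have hle : ∀ n, eLpNorm (fun x => m x * f n x - m x * g x) 2 volume ≤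
          ENNReal.ofReal B * eLpNorm (fun x => f n x - g x) 2 volume := fun n =>
        eLpNorm_le_mul_eLpNorm_of_ae_le_mul (Eventually.of_forall fun x => by
          rw [← mul_sub, norm_mul]; exact mul_le_mul_of_nonneg_right (hB x) (norm_nonneg _)) 2
      refine tendsto_of_tendsto_of_tendsto_of_le_of_le tendsto_const_nhds ?_
        (fun _ => zero_le) hle
      simpa using ENNReal.Tendsto.const_mul hfg (.inr ENNReal.ofReal_ne_top)
  have hres : ∀ {f : ℕ → EuclideanSpace ℝ (Fin d) → ℝ} {g : EuclideanSpace ℝ (Fin d) → ℝ},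
      (∀ n, Continuous (f n)) → MemLp g 2 →
      Tendsto (fun n => eLpNorm (fun x => f n x - g x) 2 volume) atTop (𝓝 0) →
      Tendsto (fun n => ∫ x in annulus d R (R + 1), f n x ^ 2) atTop
        (𝓝 (∫ x in annulus d R (R + 1), g x ^ 2)) := by
    intro f g hf hg hfg
    refine tendsto_integral_sq_of_eLpNorm (fun n => (hf n).aestronglyMeasurable)
      (hg.restrict _) ?_
    exact tendsto_of_tendsto_of_tendsto_of_le_of_le tendsto_const_nhds hfg (fun _ => zero_le)
      fun n => eLpNorm_mono_measure _ Measure.restrict_le_self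
  have cw : ∀ n, Continuous (w n) := fun n => (hw n).continuous
  have cl : ∀ n, Continuous (lap (w n)) := fun n => (hw n).lap.continuous
  refine le_of_tendsto_of_tendsto' ((hmul cw hU hwU).const_mul _)
    (((hmul cl hF hwF).const_mul 2).add
      (((hres cw hU hwU).add (hres cl hF hwF)).const_mul _)) fun n => ?_
  refine (hsmooth (w n) (hw n)).trans (le_of_eq ?_)
  have iw : IntegrableOn (fun x => w n x ^ 2) (annulus d R (R + 1)) :=
    ((cw n).pow 2).integrableOn_annulus _ _
  have il : IntegrableOn (fun x => lap (w n) x ^ 2) (annulus d R (R + 1)) :=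
    ((cl n).pow 2).integrableOn_annulus _ _
  rw [integral_add iw il]

/-- Testing with real `ψ` lets a real-linear functional pass through the integral. Real and
imaginary parts then solve real equations `ΔU = F`; a complex `V` mixes the parts, but only inside
`F`. -/
theorem IsSchrodingerSolution.integral_comp_mul_lap {V u : EuclideanSpace ℝ (Fin d) → ℂ}
    (h : IsSchrodingerSolution V u) (ℓ : ℂ →L[ℝ] ℝ) {ψ : EuclideanSpace ℝ (Fin d) → ℝ}
    (hψ : ContDiff ℝ ∞ ψ) (hψs : HasCompactSupport ψ) :
    ∫ x, ℓ (u x) * lap ψ x = ∫ x, ℓ (V x * u x) * ψ x := by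
  obtain ⟨hu, hVu, heq⟩ := h
  have hΔ : ∀ x, Laplacian.laplacian (fun y => (ψ y : ℂ)) x = (lap ψ x : ℂ) := by
    intro x
    have h2 : ContDiffAt ℝ 2 ψ x := hψ.contDiffAt.of_le
      (WithTop.coe_le_coe.2 (le_top : (2 : ℕ∞) ≤ ⊤))
    have := h2.laplacian_CLM_comp_left (l := Complex.ofRealCLM)
    rw [← laplacian_eq_lap hψ]
    exact this
  have hz := heq (fun x => (ψ x : ℂ)) (Complex.ofRealCLM.contDiff.comp hψ)
    (hψs.comp_left (g := fun r : ℝ => (r : ℂ)) Complex.ofReal_zero)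
  simp only [hΔ] at hz
  have i1 : Integrable fun x => lap ψ x • u x :=
    hu.integrable_smul_left_of_hasCompactSupport hψ.lap.continuous hψs.lap
  have i2 : Integrable fun x => ψ x • (V x * u x) :=
    hVu.integrable_smul_left_of_hasCompactSupport hψ.continuous hψs
  have e : ∀ x, u x * -(lap ψ x : ℂ) + V x * u x * (ψ x : ℂ) =
      ψ x • (V x * u x) - lap ψ x • u x := by
    intro x
    simp only [Complex.real_smul]
    ring
  simp only [e] at hz
  rw [integral_sub i2 i1, sub_eq_zero] at hz
  have h1 := ℓ.integral_comp_comm i1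
  have h2 := ℓ.integral_comp_comm i2
  simp only [map_smul, smul_eq_mul] at h1 h2
  simp only [mul_comm (ℓ _)]
  rw [h1, h2, hz]

theorem ae_norm_le_norm_of_Lp_top {α E : Type*} [MeasurableSpace α] [NormedAddCommGroup E]
    {μ : Measure α} (f : Lp E ⊤ μ) : ∀ᵐ x ∂μ, ‖f x‖ ≤ ‖f‖ := by
  filter_upwards [enorm_ae_le_eLpNormEssSup f μ] with x hx
  rw [Lp.norm_def, eLpNorm_exponent_top, ← toReal_enorm]
  refine ENNReal.toReal_mono ?_ hx
  have := (Lp.memLp f).2.ne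
  rwa [eLpNorm_exponent_top] at this

/-- The Carleman estimate for solutions of the Schrödinger equation, with the potential absorbed
on the left. -/
theorem exists_absorbed_estimate (hd : 1 ≤ d) : ∃ C : ℝ, 0 ≤ C ∧
    ∀ V : Lp ℂ ∞ (volume : Measure (EuclideanSpace ℝ (Fin d))),
    ∀ u : Lp ℂ 2 (volume : Measure (EuclideanSpace ℝ (Fin d))), IsSchrodingerSolution V u →
    ∀ R : ℝ, 1 ≤ R → ∀ a : ℝ, 0 ≤ a → a ^ 3 * (R + 1) ^ 2 = ‖V‖ ^ 2 →
      6 * ‖V‖ ^ 2 * ∫ x in Metric.closedBall 0 R, ‖u x‖ ^ 2 ≤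
        C * (1 + ‖V‖ ^ 2) * Real.exp (9 * a * (R + 1) ^ 2) *
          ∫ x in annulus d R (R + 1), ‖u x‖ ^ 2 := by
  obtain ⟨C, hC, h⟩ := exists_carleman_cutoff_weak hd
  refine ⟨C, hC, fun V u hsol R hR a ha haV => ?_⟩
  obtain ⟨m, hm, hms, hm1, hweak⟩ := h R hR a ha
  set A := annulus d R (R + 1)
  set K := ‖V‖ with hK
  have hVm : Measurable (V : EuclideanSpace ℝ (Fin d) → ℂ) := (Lp.stronglyMeasurable V).measurable
  have hum : Measurable (u : EuclideanSpace ℝ (Fin d) → ℂ) := (Lp.stronglyMeasurable u).measurable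
  have hbound : ∀ᵐ x, ‖V x * u x‖ ≤ K * ‖u x‖ := by
    filter_upwards [ae_norm_le_norm_of_Lp_top V] with x hx
    rw [norm_mul]
    exact mul_le_mul_of_nonneg_right hx (norm_nonneg _)
  have huL := Lp.memLp u
  have hVuL : MemLp (fun x => V x * u x) 2 :=
    huL.of_le_mul (hVm.mul hum).aestronglyMeasurable hbound
  -- The choice of `a` turns `8a³(R + 1)²` into `8K²`.
  have hpart : ∀ ℓ : ℂ →L[ℝ] ℝ, 8 * K ^ 2 * ∫ x, (m x * ℓ (u x)) ^ 2 ≤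
      2 * (∫ x, (m x * ℓ (V x * u x)) ^ 2) + C * Real.exp (9 * a * (R + 1) ^ 2) *
        ((∫ x in A, ℓ (u x) ^ 2) + ∫ x in A, ℓ (V x * u x) ^ 2) := by
    intro ℓ
    rw [← haV, ← mul_assoc]
    exact hweak (fun x => ℓ (u x)) (fun x => ℓ (V x * u x)) (ℓ.measurable.comp hum)
      (ℓ.comp_memLp' huL) (ℓ.measurable.comp (hVm.mul hum)) (ℓ.comp_memLp' hVuL)
      fun φ hφ hφs => hsol.integral_comp_mul_lap ℓ hφ hφs
  have hre := hpart Complex.reCLM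
  have him := hpart Complex.imCLM
  obtain ⟨B, hB⟩ := hms.exists_bound_of_continuous hm
  have hnorm : ∀ z : ℂ, ‖z‖ ^ 2 = z.re ^ 2 + z.im ^ 2 := fun z => by
    rw [Complex.sq_norm, Complex.normSq_apply]; ring
  have hmL : ∀ {f : EuclideanSpace ℝ (Fin d) → ℝ}, MemLp f 2 →
      Integrable fun x => (m x * f x) ^ 2 := by
    intro f hf
    refine MemLp.integrable_sq ?_
    exact hf.of_le_mul (c := B) (hm.aestronglyMeasurable.mul hf.1)
      (Eventually.of_forall fun x => by
        rw [norm_mul]; exact mul_le_mul_of_nonneg_right (hB x) (norm_nonneg _))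
  have hsum : ∀ {f : EuclideanSpace ℝ (Fin d) → ℂ}, MemLp f 2 →
      (∫ x, (m x * Complex.reCLM (f x)) ^ 2) + (∫ x, (m x * Complex.imCLM (f x)) ^ 2) =
        ∫ x, (m x * ‖f x‖) ^ 2 := by
    intro f hf
    have h1 : MemLp (fun x => Complex.reCLM (f x)) 2 := Complex.reCLM.comp_memLp' hf
    have h2 : MemLp (fun x => Complex.imCLM (f x)) 2 := Complex.imCLM.comp_memLp' hf
    rw [← integral_add (hmL h1) (hmL h2)]
    refine integral_congr_ae (Eventually.of_forall fun x => ?_)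
    simp only [mul_pow, hnorm, Complex.reCLM_apply, Complex.imCLM_apply]
    ring
  have hsumA : ∀ {f : EuclideanSpace ℝ (Fin d) → ℂ}, MemLp f 2 →
      (∫ x in A, Complex.reCLM (f x) ^ 2) + (∫ x in A, Complex.imCLM (f x) ^ 2) =
        ∫ x in A, ‖f x‖ ^ 2 := by
    intro f hf
    have h1 : MemLp (fun x => Complex.reCLM (f x)) 2 := Complex.reCLM.comp_memLp' hf
    have h2 : MemLp (fun x => Complex.imCLM (f x)) 2 := Complex.imCLM.comp_memLp' hf
    rw [← integral_add h1.integrable_sq.integrableOn h2.integrable_sq.integrableOn]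
    refine integral_congr_ae (Eventually.of_forall fun x => ?_)
    simp only [hnorm, Complex.reCLM_apply, Complex.imCLM_apply]
  have hpot : ∫ x, (m x * ‖V x * u x‖) ^ 2 ≤ K ^ 2 * ∫ x, (m x * ‖u x‖) ^ 2 := by
    rw [← integral_const_mul]
    refine integral_mono_ae (hmL hVuL.norm) ((hmL huL.norm).const_mul _) ?_
    filter_upwards [hbound] with x hx
    have := pow_le_pow_left₀ (norm_nonneg _) hx 2
    have := mul_le_mul_of_nonneg_left this (sq_nonneg (m x))
    linarith
  have hpotA : ∫ x in A, ‖V x * u x‖ ^ 2 ≤ K ^ 2 * ∫ x in A, ‖u x‖ ^ 2 := by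
    rw [← integral_const_mul]
    refine integral_mono_ae hVuL.norm.integrable_sq.integrableOn
      (huL.norm.integrable_sq.integrableOn.const_mul _) ?_
    filter_upwards [ae_restrict_of_ae hbound] with x hx
    have := pow_le_pow_left₀ (norm_nonneg _) hx 2
    linarith
  have hball : ∫ x in Metric.closedBall 0 R, ‖u x‖ ^ 2 ≤ ∫ x, (m x * ‖u x‖) ^ 2 := by
    rw [← integral_indicator measurableSet_closedBall]
    refine integral_mono (huL.norm.integrable_sq.indicator measurableSet_closedBall)
      (hmL huL.norm) fun x => ?_
    by_cases hx : x ∈ Metric.closedBall (0 : EuclideanSpace ℝ (Fin d)) R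
    · rw [Set.indicator_of_mem hx, mul_pow]
      exact le_mul_of_one_le_left (sq_nonneg _) (hm1 x (by simpa using hx))
    · rw [Set.indicator_of_notMem hx]; positivity
  have s1 := hsum huL
  have s2 := hsum hVuL
  have s3 := hsumA huL
  have s4 := hsumA hVuL
  set E := Real.exp (9 * a * (R + 1) ^ 2)
  have hCE : 0 ≤ C * E := by positivity
  have t1 := mul_le_mul_of_nonneg_left hball (by positivity : 0 ≤ 6 * K ^ 2)
  have t2 := mul_le_mul_of_nonneg_left hpotA hCE
  have total := add_le_add hre him
  -- Adding the two parts restores `|Vu|² ≤ K²|u|²`, so the potential costs `2K²` out of `8K²` and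
  -- leaves `6K²`.
  have total' : 8 * K ^ 2 * ∫ x, (m x * ‖u x‖) ^ 2 ≤ 2 * (∫ x, (m x * ‖V x * u x‖) ^ 2) +
      C * E * ((∫ x in A, ‖u x‖ ^ 2) + ∫ x in A, ‖V x * u x‖ ^ 2) := by
    rw [← s1, ← s2, ← s3, ← s4]
    linarith
  linarith

theorem tendsto_integral_closedBall_norm_sq {u : Lp ℂ 2 (volume : Measure (EuclideanSpace ℝ (Fin d)))}
    (hu : ‖u‖ = 1) :
    Tendsto (fun R : ℝ => ∫ x in Metric.closedBall 0 R, ‖u x‖ ^ 2) atTop (𝓝 1) := by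
  have h1 : ∫ x, ‖u x‖ ^ 2 = 1 := by
    rw [integral_sq_eq_eLpNorm (Lp.memLp u).norm.1, eLpNorm_norm, ← Lp.norm_def, hu, one_pow]
  rw [← h1]
  exact (aecover_closedBall tendsto_id).integral_tendsto_of_countably_generated
    (Lp.memLp u).norm.integrable_sq

end Main

theorem theorem3 (d : ℕ) (hd : 1 ≤ d) (C_V : ℝ) :
    ∃ M : ℝ, 0 < M ∧
      ∀ V : Lp ℂ ∞ (volume : Measure (EuclideanSpace ℝ (Fin d))), V ≠ 0 → ‖V‖ ≤ C_V →
      ∀ u : Lp ℂ 2 (volume : Measure (EuclideanSpace ℝ (Fin d))),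
        IsSchrodingerSolution V u → ‖u‖ = 1 →
        ∃ R₀ : ℝ, 0 < R₀ ∧ ∀ R : ℝ, R₀ ≤ R →
          M⁻¹ * R ^ (-(4 / 3) : ℝ) * Real.exp (-M * ‖V‖ ^ (2 / 3 : ℝ) * R ^ (4 / 3 : ℝ)) ≤
            ∫ x in annulus d R (R + 1), ‖u x‖ ^ 2 := by
  obtain ⟨C, hC, hmain⟩ := exists_absorbed_estimate hd
  -- `36 = 9 · 4` serves the exponent, with 4 from `(R + 1)^{4/3} ≤ 4R^{4/3}`; the other summand
  -- dominates the prefactor `C(1 + ‖V‖²)`. One `M` plays both roles.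
  refine ⟨36 + C * (1 + C_V ^ 2), by positivity, fun V hV hVC u hsol hu => ?_⟩
  set M := 36 + C * (1 + C_V ^ 2) with hM
  set K := ‖V‖ with hKdef
  have hK : 0 < K := norm_pos_iff.2 hV
  have ev1 := (tendsto_integral_closedBall_norm_sq hu).eventually
    (lt_mem_nhds (by norm_num : (1 / 2 : ℝ) < 1))
  -- Here `V ≠ 0` is essential: `R^{-4/3}` falls below `3K²` only from a radius that depends on `K`,
  -- which is one reason why `R₀` depends on `V`.
  have ev2 := (tendsto_rpow_neg_atTop (by norm_num : (0 : ℝ) < 4 / 3)).eventually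
    (gt_mem_nhds (by positivity : (0 : ℝ) < 3 * K ^ 2))
  obtain ⟨R₁, hR₁⟩ := Filter.eventually_atTop.1 (ev1.and ev2)
  refine ⟨max R₁ 1, by positivity, fun R hR => ?_⟩
  have hR1 : 1 ≤ R := (le_max_right _ _).trans hR
  obtain ⟨hmass, hpow⟩ := hR₁ R ((le_max_left _ _).trans hR)
  set a := K ^ (2 / 3 : ℝ) * (R + 1) ^ (-(2 / 3) : ℝ) with ha
  have hRp : 0 < R + 1 := by linarith
  have ha0 : 0 ≤ a := by positivity
  have haK : a ^ 3 * (R + 1) ^ 2 = K ^ 2 := by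
    rw [ha, mul_pow, ← Real.rpow_mul_natCast hK.le, ← Real.rpow_mul_natCast hRp.le]
    norm_num
    rw [mul_assoc, inv_mul_cancel₀ (by positivity), mul_one]
  have haX : a * (R + 1) ^ 2 ≤ 4 * (K ^ (2 / 3 : ℝ) * R ^ (4 / 3 : ℝ)) := by
    have e1 : a * (R + 1) ^ 2 = K ^ (2 / 3 : ℝ) * (R + 1) ^ (4 / 3 : ℝ) := by
      rw [ha, mul_assoc, ← Real.rpow_natCast (R + 1) 2, ← Real.rpow_add hRp]
      norm_num
    have e2 : (R + 1) ^ (4 / 3 : ℝ) ≤ 4 * R ^ (4 / 3 : ℝ) := by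
      calc (R + 1) ^ (4 / 3 : ℝ) ≤ (2 * R) ^ (4 / 3 : ℝ) :=
            Real.rpow_le_rpow hRp.le (by linarith) (by norm_num)
        _ = 2 ^ (4 / 3 : ℝ) * R ^ (4 / 3 : ℝ) := Real.mul_rpow (by norm_num) (by linarith)
        _ ≤ 2 ^ (2 : ℝ) * R ^ (4 / 3 : ℝ) := by
            gcongr <;> norm_num
        _ = _ := by norm_num
    rw [e1]
    have := mul_le_mul_of_nonneg_left e2 (by positivity : 0 ≤ K ^ (2 / 3 : ℝ))
    linarith
  have hest := hmain V u hsol R hR1 a ha0 haK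
  set J := ∫ x in annulus d R (R + 1), ‖u x‖ ^ 2 with hJ
  have hJ0 : 0 ≤ J := integral_nonneg fun x => sq_nonneg _
  set X := K ^ (2 / 3 : ℝ) * R ^ (4 / 3 : ℝ) with hX
  have hX0 : 0 ≤ X := by positivity
  have hE : Real.exp (9 * a * (R + 1) ^ 2) ≤ Real.exp (M * X) := by
    apply Real.exp_le_exp.2
    have : 0 ≤ C * (1 + C_V ^ 2) * X := by positivity
    rw [hM, add_mul]
    linarith
  have hCM : C * (1 + K ^ 2) ≤ M := by
    have h1 : K ^ 2 ≤ C_V ^ 2 := pow_le_pow_left₀ hK.le hVC 2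
    have h2 := mul_le_mul_of_nonneg_left h1 hC
    rw [hM]; linarith
  have hM0 : 0 < M := by positivity
  -- The 3 is `6 · 1/2`, using that the ball carries more than half of the mass.
  have hfin : 3 * K ^ 2 ≤ M * Real.exp (M * X) * J := by
    calc 3 * K ^ 2 ≤ 6 * K ^ 2 * ∫ x in Metric.closedBall 0 R, ‖u x‖ ^ 2 := by nlinarith [sq_pos_of_pos hK]
      _ ≤ _ := hest
      _ ≤ _ := by gcongr
  have hexp : Real.exp (-M * K ^ (2 / 3 : ℝ) * R ^ (4 / 3 : ℝ)) = (Real.exp (M * X))⁻¹ := by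
    rw [← Real.exp_neg, hX]; congr 1; ring
  rw [hexp]
  calc M⁻¹ * R ^ (-(4 / 3) : ℝ) * (Real.exp (M * X))⁻¹
      ≤ M⁻¹ * (M * Real.exp (M * X) * J) * (Real.exp (M * X))⁻¹ := by
        gcongr
        exact hpow.le.trans hfin
    _ = J := by
        have := (Real.exp_pos (M * X)).ne'
        field_simp
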